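/- **Theorem 1.5.** Conventions. A property holds for a *generic* set of $N$ points in $\mathbb{R}^3$ if it holds for all $N$-tuples in some dense open subset of $(\mathbb{R}^3)^N$ with full Lebesgue measure. A set of $N$ points can be *partitioned by* a polytope $P$ with $r$ vertices if it can be partitioned into $r$ subsets $A_1,\dots,A_r$ for which there are points $x_i\in\mathrm{Conv}(A_i)$ such that $\{x_1,\dots,x_r\}$ is the vertex set of $P$. Polytopes are *similar* if they are equal after an isometry of $\mathbb{R}^3$ composed with a uniform scaling. For a class $\mathcal{C}$ of polytopes in $\mathbb{R}^3$, let $N_{\mathcal{C}}$ be the minimum $N$ for which a generic set of $N$ points can be partitioned by a polytope similar to a member of $\mathcal{C}$. Let $\mathrm{Iso}(P)$ be the group of isometries of $\mathbb{R}^3$ that map $P$ onto itself, let $D_n$ be the dihedral group of order $2n$, and let $S_n$ and $A_n$ be the symmetric and alternating groups on $n$ elements. Let $\mathbf{T},\mathbf{O},\mathbf{I}<O(3)$ be the full groups of orthogonal symmetries of the regular tetrahedron, the cube and the regular icosahedron centered at the origin (of orders $24,48,120$). For $G$ one of these groups let $G^+=G\cap SO(3)$. A *truncated octahedron*, *truncated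 cuboctahedron* or *truncated icosidodecahedron* (not necessarily uniform) is a polytope similar to $\mathrm{Conv}(G\cdot u)$, where $u\in\mathbb{R}^3$ has trivial stabilizer in $G$ and $G=\mathbf{T},\mathbf{O},\mathbf{I}$, respectively. An *icosahedron* (realized as a snub tetrahedron), *snub cube* or *snub dodecahedron* (not necessarily uniform) is a polytope similar to $\mathrm{Conv}(G^+\cdot u)$, where $u\in\mathbb{R}^3$ has trivial stabilizer in $G$ and $G=\mathbf{T},\mathbf{O},\mathbf{I}$, respectively. Prisms and antiprisms may have any positive height; a right regular antiprism with $n$-gon base is the convex hull of a regular $n$-gon and a copy of it rotated by $\pi/n$ about its axis and lying directly above it in a parallel plane, where for $n=2$ the two $2$-gons are perpendicular congruent segments. Then: (a) $N_{Pr(n)}\le 8n-6$ for all $n\ge 3$, where $Pr(n)$ is the class of right regular prisms $P$ with regular $n$-gon base and $\mathrm{Iso}(P)\cong D_n\times\mathbb{Z}_2$. (b) $N_{APr(n)}\le 8n-6$ for all $n\ge 2$, where $APr(n)$ is the class of right regular antiprisms $P$ with regular $n$-gon base and $\mathrm{Iso}(P)\cong D_{2n}$. (c) $N_{tO}\le 90$,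 where $tO$ is the class of truncated octahedra $P$ with $\mathrm{Iso}(P)\cong S_4$. (d) $N_{tCO}\le 186$, where $tCO$ is the class of truncated cuboctahedra $P$ with $\mathrm{Iso}(P)\cong S_4\times\mathbb{Z}_2$. (e) $N_{tID}\le 474$, where $tID$ is the class of truncated icosidodecahedra $P$ with $\mathrm{Iso}(P)\cong A_5\times\mathbb{Z}_2$. (f) $N_I\le 42$, where $I$ is the class of icosahedra $P$ with $\mathrm{Iso}(P)\cong A_4$. (g) $N_{sC}\le 90$, where $sC$ is the class of snub cubes $P$ with $\mathrm{Iso}(P)\cong S_4$. (h) $N_{sD}\le 234$, where $sD$ is the class of snub dodecahedra $P$ with $\mathrm{Iso}(P)\cong A_5$. -/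

import Mathlib

open MeasureTheory

namespace PolytopalPartition

noncomputable section

/-- Euclidean space `ℝ^d`. -/
abbrev Euc (d : ℕ) : Type := EuclideanSpace ℝ (Fin d)

/-- Two subsets of `ℝ^d` are similar if one is obtained from the other by an isometry of `ℝ^d`
followed by a uniform scaling. -/
def Similar {d : ℕ} (P Q : Set (Euc d)) : Prop :=
  ∃ (e : Euc d ≃ᵢ Euc d) (s : ℝ), 0 < s ∧ Q = (fun x => s • e x) '' P

/-- The isometry group of `P ⊆ ℝ^d`: all isometries of `ℝ^d` that map `P` onto itself. -/
def Iso {d : ℕ} (P : Set (Euc d)) : Subgroup (Euc d ≃ᵢ Euc d) where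
  carrier := {e | e '' P = P}
  one_mem' := by
    change (fun x : Euc d => x) '' P = P
    exact Set.image_id' P
  mul_mem' := by
    intro e f he hf
    change e '' P = P at he
    change f '' P = P at hf
    change (fun x => e (f x)) '' P = P
    rw [← Set.image_image (fun x => e x) (fun x => f x), hf, he]
  inv_mem' := by
    intro e he
    change e '' P = P at he
    change e.symm '' P = P
    conv_lhs => rw [← he]
    rw [Set.image_image]
    simp

/-- A property holds for a generic `N`-tuple of points of `ℝ^d` if it holds on a dense open set
of tuples that has full Lebesgue measure. -/
def Generic {d N : ℕ} (p : (Fin N → Euc d) → Prop) : Prop :=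
  ∃ U : Set (Fin N → Euc d), IsOpen U ∧ Dense U ∧ volume Uᶜ = 0 ∧ ∀ x ∈ U, p x

/-- The points `x 0, …, x (N - 1)` can be `P`-partitioned: they can be divided into disjoint
classes, one class `A ⁻¹' {v}` for each vertex `v` of `P`, in such a way that every vertex of `P`
lies in the convex hull of its class. The vertices are the extreme points of `P`. -/
def CanBePartitioned {d N : ℕ} (x : Fin N → Euc d) (P : Set (Euc d)) : Prop :=
  ∃ A : Fin N → P.extremePoints ℝ,
    ∀ v : P.extremePoints ℝ, (v : Euc d) ∈ convexHull ℝ (x '' (A ⁻¹' {v}))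

/-- The number `N_C` of a class `C` of polytopes: the least `N` such that a generic set of `N`
points can be partitioned by a polytope similar to a member of `C`. It is `⊤` if there is no
such `N`. -/
def partitionNumber {d : ℕ} (C : Set (Set (Euc d))) : ℕ∞ :=
  ⨅ (N : ℕ) (_ : Generic (fun x : Fin N → Euc d =>
      ∃ P ∈ C, ∃ Q, Similar P Q ∧ CanBePartitioned x Q)), (N : ℕ∞)

/-! ### Prisms and antiprisms -/

/-- The right prism of height `2 * h` over the regular `n`-gon inscribed in the unit circle. -/
def standardPrism (n : ℕ) (h : ℝ) : Set (Euc 3) :=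
  convexHull ℝ {v | ∃ (k : ℕ) (s : ℝ), (s = 1 ∨ s = -1) ∧
    v = !₂[Real.cos (2 * Real.pi * k / n), Real.sin (2 * Real.pi * k / n), s * h]}

/-- The right antiprism of height `2 * h`: the convex hull of the regular `n`-gon inscribed in the
unit circle at height `h` and of its copy at height `-h` rotated by the angle `π / n`.
(For `n = 2` the two polygons are perpendicular segments and this is a tetrahedron.) -/
def standardAntiprism (n : ℕ) (h : ℝ) : Set (Euc 3) :=
  convexHull ℝ {v | ∃ k : ℕ,
    v = !₂[Real.cos (Real.pi * k / n), Real.sin (Real.pi * k / n), (-1) ^ k * h]}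

/-- Right (not necessarily uniform) regular prisms with regular `n`-gon base. -/
def rightRegularPrisms (n : ℕ) : Set (Set (Euc 3)) :=
  {P | ∃ h : ℝ, 0 < h ∧ Similar (standardPrism n h) P}

/-- Right (not necessarily uniform) regular antiprisms with regular `n`-gon base. -/
def rightRegularAntiprisms (n : ℕ) : Set (Set (Euc 3)) :=
  {P | ∃ h : ℝ, 0 < h ∧ Similar (standardAntiprism n h) P}

/-! ### Omnitruncated and snub polyhedra -/

/-- The subgroup of `O(d)` of all orthogonal maps that permute the set `S`. -/
def orthogonalSymmetries {d : ℕ} (S : Set (Euc d)) : Subgroup (Euc d ≃ₗᵢ[ℝ] Euc d) where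
  carrier := {g | g '' S = S}
  one_mem' := by
    change (fun x : Euc d => x) '' S = S
    exact Set.image_id' S
  mul_mem' := by
    intro e f he hf
    change e '' S = S at he
    change f '' S = S at hf
    change (fun x => e (f x)) '' S = S
    rw [← Set.image_image (fun x => e x) (fun x => f x), hf, he]
  inv_mem' := by
    intro e he
    change e '' S = S at he
    change e.symm '' S = S
    conv_lhs => rw [← he]
    rw [Set.image_image]
    simp

/-- The determinant as a homomorphism on `O(d)`. -/
def orthogonalDet (d : ℕ) : (Euc d ≃ₗᵢ[ℝ] Euc d) →* ℝ where
  toFun g := LinearMap.det g.toLinearEquiv.toLinearMap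
  map_one' := LinearMap.det_id
  map_mul' g h := LinearMap.det_comp g.toLinearEquiv.toLinearMap h.toLinearEquiv.toLinearMap

/-- The rotational subgroup `G⁺ = G ∩ SO(d)`. -/
def rotations {d : ℕ} (G : Subgroup (Euc d ≃ₗᵢ[ℝ] Euc d)) : Subgroup (Euc d ≃ₗᵢ[ℝ] Euc d) :=
  G ⊓ (orthogonalDet d).ker

/-- The orbit polytope `Conv (G · u)`. -/
def orbitPolytope {d : ℕ} (G : Subgroup (Euc d ≃ₗᵢ[ℝ] Euc d)) (u : Euc d) : Set (Euc d) :=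
  convexHull ℝ {v | ∃ g ∈ G, v = g u}

/-- `u` has trivial stabilizer in `G`. -/
def TrivialStabilizer {d : ℕ} (G : Subgroup (Euc d ≃ₗᵢ[ℝ] Euc d)) (u : Euc d) : Prop :=
  ∀ g ∈ G, g u = u → g = 1

/-- For a finite reflection group `G`: the polytopes similar to a Coxeter permutahedron of `G`,
that is, to a free orbit polytope of `G`. -/
def permutahedra {d : ℕ} (G : Subgroup (Euc d ≃ₗᵢ[ℝ] Euc d)) : Set (Set (Euc d)) :=
  {P | ∃ u : Euc d, TrivialStabilizer G u ∧ Similar (orbitPolytope G u) P}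

/-- For a finite reflection group `G`: the polytopes similar to an alternated Coxeter permutahedron
of `G`, the convex hull of those vertices `g u` of the permutahedron with `g` in `G⁺`. -/
def alternahedra {d : ℕ} (G : Subgroup (Euc d ≃ₗᵢ[ℝ] Euc d)) : Set (Set (Euc d)) :=
  {P | ∃ u : Euc d, TrivialStabilizer G u ∧ Similar (orbitPolytope (rotations G) u) P}

/-- The vertices of a regular tetrahedron. -/
def tetrahedronVertices : Set (Euc 3) :=
  {!₂[1, 1, 1], !₂[1, -1, -1], !₂[-1, 1, -1], !₂[-1, -1, 1]}

/-- The vertices of a cube. -/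
def cubeVertices : Set (Euc 3) :=
  {v | ∀ i, v i = 1 ∨ v i = -1}

/-- The vertices of a regular icosahedron: the cyclic permutations of `(0, ±1, ±φ)`, where `φ` is
the golden ratio. -/
def icosahedronVertices : Set (Euc 3) :=
  {v | ∃ s t : ℝ, (s = 1 ∨ s = -1) ∧ (t = 1 ∨ t = -1) ∧
    (v = !₂[0, s, t * Real.goldenRatio] ∨ v = !₂[t * Real.goldenRatio, 0, s] ∨
      v = !₂[s, t * Real.goldenRatio, 0])}

/-- The full isometry group of the regular tetrahedron, of order 24. -/
def tetrahedralGroup : Subgroup (Euc 3 ≃ₗᵢ[ℝ] Euc 3) := orthogonalSymmetries tetrahedronVertices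

/-- The full isometry group of the cube and of the regular octahedron, of order 48. -/
def octahedralGroup : Subgroup (Euc 3 ≃ₗᵢ[ℝ] Euc 3) := orthogonalSymmetries cubeVertices

/-- The full isometry group of the regular icosahedron and dodecahedron, of order 120. -/
def icosahedralGroup : Subgroup (Euc 3 ≃ₗᵢ[ℝ] Euc 3) := orthogonalSymmetries icosahedronVertices

/-- (Not necessarily uniform) truncated octahedra: omnitruncated tetrahedra. -/
def truncatedOctahedra : Set (Set (Euc 3)) := permutahedra tetrahedralGroup

/-- (Not necessarily uniform) truncated cuboctahedra: omnitruncated cubes. -/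
def truncatedCuboctahedra : Set (Set (Euc 3)) := permutahedra octahedralGroup

/-- (Not necessarily uniform) truncated icosidodecahedra: omnitruncated icosahedra. -/
def truncatedIcosidodecahedra : Set (Set (Euc 3)) := permutahedra icosahedralGroup

/-- (Not necessarily regular) icosahedra, realized as snub tetrahedra. -/
def snubTetrahedra : Set (Set (Euc 3)) := alternahedra tetrahedralGroup

/-- (Not necessarily uniform) snub cubes. -/
def snubCubes : Set (Set (Euc 3)) := alternahedra octahedralGroup

/-- (Not necessarily uniform) snub dodecahedra. -/
def snubDodecahedra : Set (Set (Euc 3)) := alternahedra icosahedralGroup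

/-- The members of the family `C` whose isometry group is isomorphic to `G`. -/
def withIso {d : ℕ} (C : Set (Set (Euc d))) (G : Type) [Group G] : Set (Set (Euc d)) :=
  {P | P ∈ C ∧ Nonempty (Iso P ≃* G)}

end

end PolytopalPartition

open PolytopalPartition

open MeasureTheory PolytopalPartition

namespace PolytopalPartition

/-! ### The colourful Carathéodory theorem -/

section ColorfulCaratheodory

variable {E : Type*} [NormedAddCommGroup E] [InnerProductSpace ℝ E]

theorem exists_segment_norm_lt {p q : E} (h : inner ℝ p q < ‖p‖ ^ 2) :
    ∃ r ∈ segment ℝ p q, ‖r‖ < ‖p‖ := by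
  set D := ‖p‖ ^ 2 - inner ℝ p q with hD
  have hDpos : 0 < D := by rw [hD]; linarith
  set M := ‖q - p‖ ^ 2 with hM
  have hM0 : 0 ≤ M := by positivity
  have hDM : 0 < D + M := by linarith
  -- The squared norm at time t is ‖p‖² - 2tD + t²M. The minimizer D/M may exceed 1 or be undefined;
  -- D/(D+M) lies in (0,1] and still decreases the norm.
  set t := D / (D + M) with ht
  have ht0 : 0 < t := by positivity
  have ht1 : t ≤ 1 := by rw [ht, div_le_one hDM]; linarith
  have htM : t * (D + M) = D := div_mul_cancel₀ _ hDM.ne'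
  refine ⟨p + t • (q - p), ⟨1 - t, t, by linarith, ht0.le, by ring, by module⟩, ?_⟩
  apply lt_of_pow_lt_pow_left₀ 2 (norm_nonneg _)
  rw [norm_add_sq_real, real_inner_smul_right, inner_sub_right, real_inner_self_eq_norm_sq,
    norm_smul, mul_pow, Real.norm_eq_abs, sq_abs, ← hM]
  have h1 : inner ℝ p q - ‖p‖ ^ 2 = -D := by rw [hD]; ring
  rw [h1]
  nlinarith [mul_pos ht0 hDpos, mul_pos ht0 (mul_pos ht0 hDpos)]

/-- The **colourful Carathéodory theorem**: if the origin lies in the convex hull of each of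
`dim E + 1` finite families, then it lies in the convex hull of a rainbow selection. -/
theorem exists_rainbow_zero_mem_convexHull [FiniteDimensional ℝ E] {ι κ : Type*} [Finite ι]
    [Finite κ] (hι : Module.finrank ℝ E < Nat.card ι) (S : ι → κ → E)
    (hS : ∀ i, (0 : E) ∈ convexHull ℝ (Set.range (S i))) :
    ∃ s : ι → κ, (0 : E) ∈ convexHull ℝ (Set.range fun i => S i (s i)) := by
  classical
  cases nonempty_fintype ι
  have hne : Nonempty ι := (Nat.card_pos_iff.1 (lt_of_le_of_lt (Nat.zero_le _) hι)).1
  have hκ : Nonempty κ := by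
    obtain ⟨i⟩ := hne
    exact Set.range_nonempty_iff_nonempty.1 (convexHull_nonempty_iff.1 ⟨_, hS i⟩)
  let C : (ι → κ) → Set E := fun s => convexHull ℝ (Set.range fun i => S i (s i))
  have hp : ∀ s, ∃ p ∈ C s, ∀ q ∈ C s, ‖p‖ ≤ ‖q‖ := fun s =>
    (Set.Finite.isCompact_convexHull (𝕜 := ℝ) (Set.finite_range _)).exists_isMinOn
      (convexHull_nonempty_iff.2 (Set.range_nonempty _)) continuous_norm.continuousOn
  choose p hpC hpmin using hp
  obtain ⟨s, hs⟩ := Finite.exists_min fun s => ‖p s‖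
  refine ⟨s, ?_⟩
  by_contra h0
  have hp0 : p s ≠ 0 := fun h => h0 (h ▸ hpC s)
  have hconv : ∀ s, Convex ℝ (C s) := fun s => convex_convexHull ℝ _
  have hge : ∀ q ∈ C s, ‖p s‖ ^ 2 ≤ inner ℝ (p s) q := by
    intro q hq
    by_contra hlt
    obtain ⟨r, hr, hr'⟩ := exists_segment_norm_lt (not_le.1 hlt)
    exact absurd (hpmin s r ((hconv s).segment_subset (hpC s) hq hr)) (not_le.2 hr')
  -- The hyperplane through `p s` orthogonal to it supports the hull. Since `p s` lies on it, only
  -- the points on this hyperplane can carry weight.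
  set T : Set E := {z | z ∈ Set.range (fun i => S i (s i)) ∧ inner ℝ (p s) z = ‖p s‖ ^ 2}
  have hpT : p s ∈ convexHull ℝ T := by
    have h1 := hpC s
    obtain ⟨w, hw0, hw1, hwp⟩ : ∃ w : ι → ℝ, (∀ i, 0 ≤ w i) ∧ ∑ i, w i = 1 ∧
        ∑ i, w i • S i (s i) = p s := by
      have := h1
      simp only [C] at this
      rw [convexHull_range_eq_exists_affineCombination] at this
      obtain ⟨t, w, hw0, hw1, hwp⟩ := this
      rw [Finset.affineCombination_eq_linear_combination _ _ _ hw1] at hwp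
      refine ⟨fun i => if i ∈ t then w i else 0, fun i => ?_, ?_, ?_⟩
      · dsimp only; split_ifs with hi; exacts [hw0 i hi, le_rfl]
      · simpa using hw1
      · simpa [ite_smul] using hwp
    have hzero : ∀ i, w i ≠ 0 → S i (s i) ∈ T := by
      intro i hi
      refine ⟨⟨i, rfl⟩, ?_⟩
      have hsum : ∑ i, w i * (inner ℝ (p s) (S i (s i)) - ‖p s‖ ^ 2) = 0 := by
        have : inner ℝ (p s) (∑ i, w i • S i (s i)) = ‖p s‖ ^ 2 := by
          rw [hwp, real_inner_self_eq_norm_sq]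
        rw [inner_sum] at this
        simp only [real_inner_smul_right] at this
        simp only [mul_sub, Finset.sum_sub_distrib, this, ← Finset.sum_mul, hw1, one_mul, sub_self]
      have hnn : ∀ i ∈ Finset.univ, 0 ≤ w i * (inner ℝ (p s) (S i (s i)) - ‖p s‖ ^ 2) :=
        fun i _ => mul_nonneg (hw0 i) (sub_nonneg.2 (hge _ (subset_convexHull _ _ ⟨i, rfl⟩)))
      have := (Finset.sum_eq_zero_iff_of_nonneg hnn).1 hsum i (Finset.mem_univ i)
      rcases mul_eq_zero.1 this with h | h
      · exact absurd h hi
      · linarith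
    rw [← hwp, ← Finset.sum_filter_of_ne (p := fun i => w i ≠ 0)
      (fun i _ h => fun h' => h (by rw [h', zero_smul]))]
    refine (convex_convexHull ℝ T).sum_mem (fun i _ => hw0 i) ?_ ?_
    · rwa [Finset.sum_filter_ne_zero]
    · exact fun i hi => subset_convexHull _ _ (hzero i (Finset.mem_filter.1 hi).2)
  obtain ⟨ν, hν, z, w, hzT, hzaff, hw0, hw1, hwz⟩ := eq_pos_convex_span_of_mem_convexHull hpT
  -- The hyperplane misses the origin, so affine independence upgrades to linear independence.
  -- Carathéodory thus uses at most dim E points instead of dim E + 1, and some colour remains free.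
  have hlin : LinearIndependent ℝ z := by
    rw [Fintype.linearIndependent_iff]
    intro g hg
    have hsum : ∑ i, g i = 0 := by
      have h1 : inner ℝ (p s) (∑ i, g i • z i) = 0 := by rw [hg, inner_zero_right]
      rw [inner_sum] at h1
      simp only [real_inner_smul_right, fun i => (hzT ⟨i, rfl⟩ : z i ∈ T).2] at h1
      rw [← Finset.sum_mul] at h1
      exact (mul_eq_zero.1 h1).resolve_right (pow_ne_zero 2 (norm_ne_zero_iff.2 hp0))
    exact fun i => (affineIndependent_iff.1 hzaff) Finset.univ g hsum hg i (Finset.mem_univ i)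
  have hidx : ∀ k, ∃ i, S i (s i) = z k := fun k => (hzT ⟨k, rfl⟩ : z k ∈ T).1
  choose f hf using hidx
  obtain ⟨i₀, hi₀⟩ : ∃ i₀, ∀ k, f k ≠ i₀ := by
    by_contra! hcon
    have h1 : Fintype.card ι ≤ Fintype.card ν := Fintype.card_le_of_surjective f hcon
    have h2 := hlin.fintype_card_le_finrank
    rw [Nat.card_eq_fintype_card] at hι
    omega
  obtain ⟨k₀, hk₀⟩ : ∃ k, inner ℝ (p s) (S i₀ k) ≤ 0 := by
    by_contra! hcon
    have hsub : convexHull ℝ (Set.range (S i₀)) ⊆ {x | 0 < inner ℝ (p s) x} := by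
      refine convexHull_min ?_ ?_
      · rintro _ ⟨k, rfl⟩; exact hcon k
      · exact convex_halfSpace_gt (f := fun x => inner ℝ (p s) x)
          ⟨fun x y => inner_add_right _ _ _, fun c x => real_inner_smul_right _ _ _⟩ 0
    have := hsub (hS i₀)
    simp at this
  -- Exchanging the point of the unused colour keeps `p s` in the hull and adds a point beyond the
  -- hyperplane, so the new hull comes closer to the origin than the minimum.
  let s' := Function.update s i₀ k₀
  have hpC' : p s ∈ C s' := by
    rw [← hwz]
    refine (hconv s').sum_mem (fun i _ => (hw0 i).le) hw1 fun k _ => subset_convexHull _ _ ?_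
    exact ⟨f k, by simp only [s', Function.update_of_ne (hi₀ k), hf]⟩
  have hqC' : S i₀ k₀ ∈ C s' := subset_convexHull _ _ ⟨i₀, by simp [s']⟩
  have hlt : inner ℝ (p s) (S i₀ k₀) < ‖p s‖ ^ 2 :=
    lt_of_le_of_lt hk₀ (pow_pos (norm_pos_iff.2 hp0) 2)
  obtain ⟨r, hr, hr'⟩ := exists_segment_norm_lt hlt
  have h1 := hpmin s' r ((hconv s').segment_subset hpC' hqC' hr)
  exact absurd (hs s') (not_le.2 (lt_of_le_of_lt h1 hr'))

end ColorfulCaratheodory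

/-! ### Partitions along an affine family of labelled point configurations -/

section LinearFamily

variable {d N : ℕ} {G : Type*} [Fintype G] [DecidableEq G]

/-- The affine family `(c, u) ↦ (g ↦ c + L u g)` of labelled point configurations. -/
def configuration (L : Euc d →ₗ[ℝ] (G → Euc d)) : (Euc d × Euc d) →ₗ[ℝ] (G → Euc d) where
  toFun p g := p.1 + L p.2 g
  map_add' p q := by ext g : 1; simp only [Prod.fst_add, Prod.snd_add, map_add, Pi.add_apply]; abel
  map_smul' t p := by ext g : 1; simp

omit [Fintype G] [DecidableEq G] in
@[simp]
theorem configuration_apply (L : Euc d →ₗ[ℝ] (G → Euc d)) (p : Euc d × Euc d) (g : G) :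
    configuration L p g = p.1 + L p.2 g := rfl

/-- Nonnegative weights that sum up to `1` over each class of the labelling `α`. -/
def classWeights (α : Fin N → G) : Set (Fin N → ℝ) :=
  {w | (∀ i, 0 ≤ w i) ∧ ∀ g, ∑ i with α i = g, w i = 1}

/-- The weighted mean of each class. -/
def classMeans (α : Fin N → G) (x : Fin N → Euc d) (w : Fin N → ℝ) (g : G) : Euc d :=
  ∑ i with α i = g, w i • x i

/-- Sarkaria's trick. The point `x i`, lifted to `(x i, 1)`, is placed in slot `g` of `G → ℝ^d × ℝ`,
and the |G| possible slots form the colour class of `i`. The extra real coordinate records the total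
weight of each class; being constant on admissible tuples, it forces all classes to weigh the same.
A rainbow combination that vanishes modulo the admissible tuples is exactly the required labelling
with weights. -/
theorem exists_classMeans_eq_configuration (L : Euc d →ₗ[ℝ] (G → Euc d))
    (hL : Function.Injective (configuration L)) (hG : 2 ≤ Fintype.card G)
    (hN : N + 2 * d = (d + 1) * Fintype.card G) (x : Fin N → Euc d) :
    ∃ α : Fin N → G, ∃ w ∈ classWeights α, ∃ p, classMeans α x w = configuration L p := by
  classical
  let Φ : ((Euc d × Euc d) × ℝ) →ₗ[ℝ] (G → Euc d × ℝ) :=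
    { toFun := fun p g => (configuration L p.1 g, p.2)
      map_add' := fun p q => by ext g : 1; simp [add_add_add_comm]
      map_smul' := fun t p => by ext g : 1; simp }
  have hG0 : 0 < Fintype.card G := by omega
  obtain ⟨g₀⟩ : Nonempty G := Fintype.card_pos_iff.1 hG0
  have hΦ : Function.Injective Φ := by
    intro p q h
    have h1 : ∀ g, configuration L p.1 g = configuration L q.1 g ∧ p.2 = q.2 := fun g =>
      Prod.mk.inj (congrFun h g)
    exact Prod.ext (hL (funext fun g => (h1 g).1)) (h1 g₀).2
  set K := LinearMap.range Φ
  have hK : Module.finrank ℝ K = 2 * d + 1 := by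
    rw [LinearMap.finrank_range_of_inj hΦ]; simp; ring
  have hQ := Submodule.finrank_quotient_add_finrank K
  have hF : Module.finrank ℝ (G → Euc d × ℝ) = Fintype.card G * (d + 1) := by
    rw [Module.finrank_pi_fintype]; simp
  rw [hK, hF] at hQ
  let E := EuclideanSpace ℝ (Fin (Module.finrank ℝ ((G → Euc d × ℝ) ⧸ K)))
  let e : ((G → Euc d × ℝ) ⧸ K) ≃ₗ[ℝ] E := LinearEquiv.ofFinrankEq _ _ (by simp [E])
  let π : (G → Euc d × ℝ) →ₗ[ℝ] E := e.toLinearMap ∘ₗ K.mkQ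
  have hπ : ∀ f, π f = 0 ↔ f ∈ K := fun f => by simp [π]
  let S : Fin N → G → E := fun i g => π (Pi.single g (x i, 1))
  have hS : ∀ i, (0 : E) ∈ convexHull ℝ (Set.range (S i)) := by
    intro i
    have h1 : ∑ g, (1 / (Fintype.card G : ℝ)) • S i g = 0 := by
      -- The tuple with all slots equal to `(x i, 1)` is the degenerate configuration with c = `x i`
      -- and u = 0, so the barycentre of each colour class vanishes in the quotient.
      have h2 : ∑ g, Pi.single (M := fun _ : G => Euc d × ℝ) g (x i, (1 : ℝ)) ∈ K := by
        refine ⟨((x i, 0), 1), ?_⟩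
        ext g : 1
        simp [Φ, Finset.sum_apply, Pi.single_apply]
      rw [← Finset.smul_sum, ← map_sum, (hπ _).2 h2, smul_zero]
    rw [← h1]
    refine (convex_convexHull ℝ _).sum_mem (fun _ _ => by positivity) ?_
      fun g _ => subset_convexHull _ _ ⟨g, rfl⟩
    rw [Finset.sum_const, Finset.card_univ, nsmul_eq_mul]
    field_simp
  have hcard : Module.finrank ℝ E < Nat.card (Fin N) := by
    simp only [E, finrank_euclideanSpace, Fintype.card_fin, Nat.card_eq_fintype_card]
    nlinarith
  obtain ⟨α, hα⟩ := exists_rainbow_zero_mem_convexHull hcard S hS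
  rw [convexHull_range_eq_exists_affineCombination] at hα
  obtain ⟨s, w, hw0, hw1, hwp⟩ := hα
  rw [Finset.affineCombination_eq_linear_combination _ _ _ hw1] at hwp
  have h1 : ∑ i ∈ s, w i • Pi.single (M := fun _ : G => Euc d × ℝ) (α i) (x i, (1 : ℝ)) ∈ K := by
    rw [← hπ, map_sum, ← hwp]
    simp [S]
  obtain ⟨⟨p, t⟩, hpt⟩ := h1
  have hval : ∀ g, configuration L p g = ∑ i ∈ s with α i = g, w i • x i ∧
      t = ∑ i ∈ s with α i = g, w i := by
    intro g
    have h2 := congrFun hpt g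
    rw [Finset.sum_apply] at h2
    have h3 : ∀ i, (w i • Pi.single (M := fun _ : G => Euc d × ℝ) (α i) (x i, (1 : ℝ))) g
        = if α i = g then (w i • x i, w i) else 0 := by
      intro i
      simp [Pi.single_apply, eq_comm]
    simp only [h3, ← Finset.sum_filter] at h2
    have h4 := congrArg Prod.fst h2
    have h5 := congrArg Prod.snd h2
    rw [Prod.fst_sum] at h4
    rw [Prod.snd_sum] at h5
    exact ⟨h4, h5⟩
  -- The |G| classes have the common weight `t` and total weight 1. Scaling by |G| normalizes every
  -- class.
  have ht : (Fintype.card G : ℝ) * t = 1 := by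
    rw [← hw1, ← Finset.sum_fiberwise s α w]
    simp [← fun g => (hval g).2]
  set r : ℝ := ((Fintype.card G : ℕ) : ℝ)
  have hr : 0 ≤ r := by positivity
  refine ⟨α, fun i => r * (if i ∈ s then w i else 0), ⟨fun i => ?_, fun g => ?_⟩, r • p, ?_⟩
  · refine mul_nonneg hr ?_
    split_ifs with hi
    exacts [hw0 i hi, le_rfl]
  · rw [← Finset.mul_sum, ← Finset.sum_filter, Finset.filter_filter, ← ht, (hval g).2]
    congr 2
    ext i; simp [and_comm]
  · rw [map_smul]
    ext g : 1
    rw [Pi.smul_apply, (hval g).1, classMeans, Finset.smul_sum]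
    simp only [mul_ite, mul_zero, ite_smul, zero_smul, ← Finset.sum_filter, Finset.filter_filter,
      mul_smul]
    congr 1
    ext i; simp [and_comm]

/-- The point configurations for which the labelling `α` admits weights with class means in the
affine family of `L`, with parameter in `B`. -/
def labelledSolutions (L : Euc d →ₗ[ℝ] (G → Euc d)) (B : Set (Euc d)) (α : Fin N → G) :
    Set (Fin N → Euc d) :=
  {x | ∃ w ∈ classWeights α, ∃ p : Euc d × Euc d, p.2 ∈ B ∧ classMeans α x w = configuration L p}

omit [Fintype G] in
theorem isCompact_classWeights (α : Fin N → G) : IsCompact (classWeights α) := by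
  have hsub : classWeights α ⊆ Set.Icc 0 1 := by
    refine fun w hw => ⟨hw.1, fun i => ?_⟩
    rw [Pi.one_apply, ← hw.2 (α i)]
    exact Finset.single_le_sum (f := w) (fun j _ => hw.1 j) (by simp)
  refine isCompact_Icc.of_isClosed_subset ?_ hsub
  simp only [classWeights, Set.ofPred_and, Set.ofPred_forall]
  refine (isClosed_iInter fun i => isClosed_le continuous_const (continuous_apply i)).inter
    (isClosed_iInter fun g => isClosed_eq ?_ continuous_const)
  fun_prop

-- An injective linear map is a closed embedding, so the admissible configurations with parameter in
-- `B` form a closed set. The weights range over a compact space, along which projection preserves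
-- closedness.
omit [Fintype G] in
theorem isClosed_labelledSolutions (L : Euc d →ₗ[ℝ] (G → Euc d))
    (hL : Function.Injective (configuration L)) {B : Set (Euc d)} (hB : IsClosed B)
    (α : Fin N → G) : IsClosed (labelledSolutions L B α) := by
  have hemb : Topology.IsClosedEmbedding (configuration L) :=
    LinearMap.isClosedEmbedding_of_injective (LinearMap.ker_eq_bot.2 hL)
  have hC : IsClosed (configuration L '' (Prod.snd ⁻¹' B)) :=
    hemb.isClosedMap _ (hB.preimage continuous_snd)
  have : CompactSpace (classWeights α) := isCompact_iff_compactSpace.1 (isCompact_classWeights α)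
  let m : (Fin N → Euc d) × classWeights α → G → Euc d := fun q => classMeans α q.1 q.2
  have hm : Continuous m := by
    refine continuous_pi fun g => ?_
    exact continuous_finsetSum _ fun i _ => ((continuous_apply i).comp
      (continuous_subtype_val.comp continuous_snd)).smul ((continuous_apply i).comp continuous_fst)
  have := isClosedMap_fst_of_compactSpace _ (hC.preimage hm)
  convert this using 1
  ext x
  constructor
  · rintro ⟨w, hw, p, hp, h⟩
    exact ⟨(x, ⟨w, hw⟩), ⟨p, hp, h.symm⟩, rfl⟩
  · rintro ⟨⟨x, ⟨w, hw⟩⟩, ⟨p, hp, h⟩, rfl⟩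
    exact ⟨w, hw, p, hp, h.symm⟩

/-- A differentiable map between spaces of the same dimension maps the part of its domain that
lies over a null set of a linear projection to a null set. -/
theorem measure_image_preimage_linearMap_eq_zero {E F U : Type*} [NormedAddCommGroup E]
    [NormedSpace ℝ E] [FiniteDimensional ℝ E] [NormedAddCommGroup F] [NormedSpace ℝ F]
    [FiniteDimensional ℝ F] [MeasurableSpace F] [BorelSpace F] [NormedAddCommGroup U]
    [NormedSpace ℝ U] [FiniteDimensional ℝ U] [MeasurableSpace U] [BorelSpace U]
    (μ : Measure F) [μ.IsAddHaarMeasure] (ν : Measure U) [ν.IsAddHaarMeasure]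
    (hdim : Module.finrank ℝ E = Module.finrank ℝ F) (P : E →ₗ[ℝ] U)
    (hP : Function.Surjective P) {B : Set U} (hBm : MeasurableSet B) (hB : ν B = 0)
    {f : E → F} {s : Set E} (hf : DifferentiableOn ℝ f s) (hs : s ⊆ P ⁻¹' B) :
    μ (f '' s) = 0 := by
  let e : F ≃ₗ[ℝ] E := LinearEquiv.ofFinrankEq _ _ hdim.symm
  let e' : F ≃L[ℝ] E := e.toContinuousLinearEquiv
  -- The preimage of a null set under a surjective linear map is null.
  have h1 : ∀ᵐ x ∂μ, (P ∘ₗ e.toLinearMap) x ∈ Bᶜ :=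
    (ae_comp_linearMap_mem_iff (P ∘ₗ e.toLinearMap) μ ν (hP.comp e.surjective) hBm.compl).2
      (compl_mem_ae_iff.2 hB)
  have h2 : μ (e' ⁻¹' s) = 0 := by
    refine measure_mono_null (fun x hx => ?_) h1
    exact fun h => h (hs hx)
  have h3 : f '' s = (f ∘ e') '' (e' ⁻¹' s) := by
    rw [Set.image_comp, Set.image_preimage_eq _ e'.surjective]
  rw [h3]
  exact addHaar_image_eq_zero_of_differentiableOn_of_addHaar_eq_zero μ
    (hf.comp e'.differentiable.differentiableOn fun x hx => hx) h2

/-- The indices that are not selected by `s`. -/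
abbrev Unselected (s : G → Fin N) : Type := {i // i ∉ Set.range s}

open Classical in
theorem sum_class_eq_add_sum_compl_range {M : Type*} [AddCommMonoid M] {α : Fin N → G}
    {s : G → Fin N} (hs : ∀ g, α (s g) = g) (F : Fin N → M) (g : G) :
    ∑ i with α i = g, F i =
      F (s g) + ∑ j : Unselected s with α j.1 = g, F j.1 := by
  rw [Finset.sum_filter, Finset.sum_filter,
    ← Fintype.sum_subtype_add_sum_subtype (fun i => i ∈ Set.range s)]
  congr 1
  rw [Finset.sum_eq_single ⟨s g, g, rfl⟩]
  · simp [hs]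
  · rintro ⟨_, g', rfl⟩ - h
    rw [if_neg]
    rintro h'
    apply h
    simp only [hs] at h'
    simp [h']
  · simp

open Classical in
/-- The points are recovered from the parameters of the family, the points that are not selected
by `s`, and their weights. -/
noncomputable def reconstruct (L : Euc d →ₗ[ℝ] (G → Euc d)) (α : Fin N → G) (s : G → Fin N)
    (q : ((Unselected s → ℝ) × (Unselected s → Euc d)) × (Euc d × Euc d))
    (i : Fin N) : Euc d :=
  if h : i ∈ Set.range s then
    (1 - ∑ j : Unselected s with α j.1 = α i, q.1.1 j)⁻¹ •
      (configuration L q.2 (α i) - ∑ j : Unselected s with α j.1 = α i, q.1.1 j • q.1.2 j)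
  else q.1.2 ⟨i, h⟩

-- Every class contains a point of nonzero weight, and that point can be solved for in terms of the
-- parameters and of the other points and weights. This exhibits the solutions as differentiable
-- images of spaces of dimension (N - |G|)(d+1) + 2d = Nd, equal to that of the target, so
-- restricting `u` to a null set makes the image null.
open Classical in
theorem volume_labelledSolutions_eq_zero (L : Euc d →ₗ[ℝ] (G → Euc d))
    (hN : N + 2 * d = (d + 1) * Fintype.card G)
    {B : Set (Euc d)} (hB : IsClosed B) (hB0 : volume B = 0)
    (α : Fin N → G) : volume (labelledSolutions L B α) = 0 := by
  let D : ∀ s : G → Fin N, Set (((Unselected s → ℝ) × (Unselected s → Euc d)) ×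
      (Euc d × Euc d)) := fun s =>
    {q | q.2.2 ∈ B ∧ ∀ g, 1 - ∑ j : Unselected s with α j.1 = g, q.1.1 j ≠ 0}
  have hsub : labelledSolutions L B α ⊆
      ⋃ s ∈ {s : G → Fin N | ∀ g, α (s g) = g}, reconstruct L α s '' D s := by
    rintro x ⟨w, hw, p, hp, h⟩
    have h1 : ∀ g, ∃ i, α i = g ∧ w i ≠ 0 := by
      intro g
      obtain ⟨i, hi, hi'⟩ := Finset.exists_ne_zero_of_sum_ne_zero
        (by rw [hw.2 g]; exact one_ne_zero : ∑ i with α i = g, w i ≠ 0)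
      exact ⟨i, (Finset.mem_filter.1 hi).2, hi'⟩
    choose s hs hs' using h1
    -- The weight of the selected point is what remains of the total weight 1 of its class.
    have h2 : ∀ g, 1 - ∑ j : Unselected s with α j.1 = g, w j.1 = w (s g) := by
      intro g
      rw [← hw.2 g, sum_class_eq_add_sum_compl_range hs]
      ring
    refine Set.mem_biUnion (show s ∈ {s : G → Fin N | ∀ g, α (s g) = g} from hs)
      ⟨((fun j => w j.1, fun j => x j.1), p), ⟨hp, fun g => ?_⟩, ?_⟩
    · dsimp only
      rw [h2]
      exact hs' g
    · ext1 i
      rw [reconstruct]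
      split_ifs with hi
      · obtain ⟨g, rfl⟩ := hi
        dsimp only
        rw [h2, hs, ← h, classMeans, sum_class_eq_add_sum_compl_range hs, add_sub_cancel_right,
          smul_smul, inv_mul_cancel₀ (hs' g), one_smul]
      · rfl
  refine measure_mono_null hsub ((measure_biUnion_null_iff (Set.to_countable _)).2 fun s hs => ?_)
  have hsinj : Function.Injective s := Function.LeftInverse.injective hs
  let P : (((Unselected s → ℝ) × (Unselected s → Euc d)) ×
      (Euc d × Euc d)) →ₗ[ℝ] Euc d := LinearMap.snd ℝ _ _ ∘ₗ LinearMap.snd ℝ _ _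
  have hcard : Fintype.card (Unselected s) + Fintype.card G = N := by
    have h1 : Fintype.card (Unselected s) = _ :=
      Fintype.card_subtype_compl (fun i => i ∈ Set.range s)
    have h2 : Fintype.card {i // i ∈ Set.range s} = Fintype.card G :=
      Set.card_range_of_injective hsinj
    have h3 := Fintype.card_subtype_le (fun i => i ∈ Set.range s)
    rw [Fintype.card_fin] at h1 h3
    omega
  refine measure_image_preimage_linearMap_eq_zero (f := reconstruct L α s) (s := D s)
    volume volume ?_ P ?_ hB.measurableSet hB0 ?_ (fun q hq => hq.1)
  · simp only [Module.finrank_prod, Module.finrank_pi_fintype, Module.finrank_self,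
      finrank_euclideanSpace, Fintype.card_fin, Finset.sum_const, Finset.card_univ, smul_eq_mul]
    nlinarith
  · exact fun u => ⟨(0, (0, u)), rfl⟩
  · refine differentiableOn_pi.2 fun i => ?_
    by_cases hi : i ∈ Set.range s
    · have h1 : ∀ q, reconstruct L α s q i =
          (1 - ∑ j : Unselected s with α j.1 = α i, q.1.1 j)⁻¹ •
          (configuration L q.2 (α i) -
            ∑ j : Unselected s with α j.1 = α i, q.1.1 j • q.1.2 j) :=
        fun q => dif_pos hi
      simp only [h1]
      have h2 : Differentiable ℝ fun p => configuration L p (α i) :=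
        differentiable_pi.1 (LinearMap.toContinuousLinearMap (configuration L)).differentiable _
      refine DifferentiableOn.fun_smul (DifferentiableOn.fun_inv ?_ fun q hq => hq.2 (α i)) ?_
      · exact Differentiable.differentiableOn (by fun_prop)
      · refine Differentiable.differentiableOn ((h2.comp differentiable_snd).sub ?_)
        fun_prop
    · have h1 : ∀ q, reconstruct L α s q i = q.1.2 ⟨i, hi⟩ := fun q => dif_neg hi
      simp only [h1]
      exact Differentiable.differentiableOn (by fun_prop)

/-- A generic set of `(d + 1) |G| - 2 d` points can be divided into classes labelled by `G` whose
convex hulls meet a configuration of the affine family of `L`, with parameter outside any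
given closed null set. -/
theorem generic_exists_configuration (L : Euc d →ₗ[ℝ] (G → Euc d))
    (hL : Function.Injective (configuration L)) (hG : 2 ≤ Fintype.card G)
    (hN : N + 2 * d = (d + 1) * Fintype.card G)
    {B : Set (Euc d)} (hB : IsClosed B) (hB0 : volume B = 0) :
    Generic fun x : Fin N → Euc d => ∃ u ∉ B, ∃ (c : Euc d) (α : Fin N → G),
      ∀ g, c + L u g ∈ convexHull ℝ (x '' (α ⁻¹' {g})) := by
  have hnull : volume (⋃ α : Fin N → G, labelledSolutions L B α) = 0 :=
    measure_iUnion_null fun α => volume_labelledSolutions_eq_zero L hN hB hB0 α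
  refine ⟨(⋃ α : Fin N → G, labelledSolutions L B α)ᶜ,
    (isClosed_iUnion_of_finite fun α => isClosed_labelledSolutions L hL hB α).isOpen_compl,
    ?_, by rwa [compl_compl], ?_⟩
  · exact Measure.dense_of_ae (μ := volume) (compl_mem_ae_iff.2 hnull)
  · intro x hx
    obtain ⟨α, w, hw, p, hp⟩ := exists_classMeans_eq_configuration L hL hG hN x
    refine ⟨p.2, fun hpB => hx (Set.mem_iUnion.2 ⟨α, w, hw, p, hpB, hp⟩), p.1, α, fun g => ?_⟩
    rw [← configuration_apply, ← hp]
    exact (convex_convexHull ℝ _).sum_mem (fun i _ => hw.1 i) (hw.2 g) fun i hi =>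
      subset_convexHull _ _ ⟨i, (Finset.mem_filter.1 hi).2, rfl⟩

end LinearFamily

/-! ### Point configurations, Gram matrices and isometry groups -/

section Gram

variable {E X : Type*} [NormedAddCommGroup E] [InnerProductSpace ℝ E]

theorem inner_linearCombination_eq_of_gram_eq {v v' : X → E}
    (hgram : ∀ x y, inner ℝ (v' x) (v' y) = inner ℝ (v x) (v y)) (a b : X →₀ ℝ) :
    inner ℝ (Finsupp.linearCombination ℝ v' a) (Finsupp.linearCombination ℝ v' b) =
      inner ℝ (Finsupp.linearCombination ℝ v a) (Finsupp.linearCombination ℝ v b) := by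
  simp only [Finsupp.linearCombination_apply, Finsupp.sum, sum_inner, inner_sum,
    real_inner_smul_left, real_inner_smul_right, hgram]

/-- Two configurations with the same Gram matrix, one of which spans, are related by a linear
isometry. -/
theorem exists_linearIsometryEquiv_of_gram_eq [FiniteDimensional ℝ E] {v v' : X → E}
    (hgram : ∀ x y, inner ℝ (v' x) (v' y) = inner ℝ (v x) (v y))
    (hspan : Submodule.span ℝ (Set.range v) = ⊤) :
    ∃ e : E ≃ₗᵢ[ℝ] E, ∀ x, e (v x) = v' x := by
  set T := Finsupp.linearCombination ℝ v with hT
  set T' := Finsupp.linearCombination ℝ v' with hT'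
  have hsurj : LinearMap.range T = ⊤ := by rw [Finsupp.range_linearCombination, hspan]
  obtain ⟨S, hS⟩ := T.exists_rightInverse_of_surjective hsurj
  have hS' : ∀ y, T (S y) = y := fun y => LinearMap.congr_fun hS y
  have hnorm : ∀ a, ‖T' a‖ = ‖T a‖ := fun a => by
    have := inner_linearCombination_eq_of_gram_eq hgram a a
    rw [← hT, ← hT', real_inner_self_eq_norm_sq, real_inner_self_eq_norm_sq] at this
    exact (pow_left_inj₀ (norm_nonneg _) (norm_nonneg _) two_ne_zero).1 this
  let e : E →ₗᵢ[ℝ] E := ⟨T' ∘ₗ S, fun y => by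
    rw [LinearMap.comp_apply, hnorm, hS']⟩
  refine ⟨e.toLinearIsometryEquiv rfl, fun x => ?_⟩
  -- Equal Gram matrices give `T` and `T'` the same kernel, so the choice of the section `S` does
  -- not matter.
  have h1 : T' (S (v x) - Finsupp.single x 1) = 0 := by
    rw [← norm_eq_zero, hnorm, map_sub, hS', hT, Finsupp.linearCombination_single, one_smul,
      sub_self, norm_zero]
  rw [map_sub, sub_eq_zero] at h1
  change T' (S (v x)) = v' x
  rw [h1, hT', Finsupp.linearCombination_single, one_smul]

theorem linearIsometryEquiv_ext_of_span {v : X → E}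
    (hspan : Submodule.span ℝ (Set.range v) = ⊤) {e e' : E ≃ₗᵢ[ℝ] E}
    (h : ∀ x, e (v x) = e' (v x)) : e = e' := by
  have : e.toLinearEquiv.toLinearMap = e'.toLinearEquiv.toLinearMap :=
    LinearMap.ext_on_range hspan h
  ext y
  exact LinearMap.congr_fun this y

/-- A group that acts on the index set of a spanning configuration and preserves its Gram matrix
acts by linear isometries. -/
theorem exists_monoidHom_of_gram_smul [FiniteDimensional ℝ E] {K : Type*} [Group K]
    [MulAction K X] {v : X → E}
    (hgram : ∀ (k : K) x y, inner ℝ (v (k • x)) (v (k • y)) = inner ℝ (v x) (v y))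
    (hspan : Submodule.span ℝ (Set.range v) = ⊤) :
    ∃ ρ : K →* (E ≃ₗᵢ[ℝ] E), ∀ k x, ρ k (v x) = v (k • x) := by
  choose ρ hρ using fun k : K =>
    exists_linearIsometryEquiv_of_gram_eq (v' := fun x => v (k • x)) (hgram k) hspan
  refine ⟨⟨⟨ρ, ?_⟩, ?_⟩, hρ⟩
  · refine linearIsometryEquiv_ext_of_span hspan fun x => ?_
    rw [hρ, one_smul]; rfl
  · intro k l
    refine linearIsometryEquiv_ext_of_span hspan fun x => ?_
    change _ = ρ k (ρ l (v x))
    rw [hρ, mul_smul, hρ, hρ]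

end Gram

/-! ### Symmetries of spanning configurations and of polytopes inscribed in a sphere. -/

variable {d : ℕ}

theorem mem_orthogonalSymmetries {S : Set (Euc d)} {e : Euc d ≃ₗᵢ[ℝ] Euc d} :
    e ∈ orthogonalSymmetries S ↔ e '' S = S := Iff.rfl

theorem mem_Iso {S : Set (Euc d)} {e : Euc d ≃ᵢ Euc d} : e ∈ Iso S ↔ e '' S = S := Iff.rfl

/-- The symmetries of a spanning configuration are the group `K`, provided that `K` realizes all
permutations that preserve the Gram matrix. -/
theorem exists_mulEquiv_orthogonalSymmetries {X K : Type*} [Finite X] [Group K] [MulAction K X]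
    [FaithfulSMul K X] {v : X → Euc d} (hv : Function.Injective v)
    (hgram : ∀ (k : K) x y, inner ℝ (v (k • x)) (v (k • y)) = inner ℝ (v x) (v y))
    (hspan : Submodule.span ℝ (Set.range v) = ⊤)
    (hall : ∀ σ : Equiv.Perm X,
      (∀ x y, inner ℝ (v (σ x)) (v (σ y)) = inner ℝ (v x) (v y)) → ∃ k : K, ∀ x, σ x = k • x) :
    ∃ Ψ : K ≃* orthogonalSymmetries (Set.range v), ∀ k x, (Ψ k).1 (v x) = v (k • x) := by
  obtain ⟨ρ, hρ⟩ := exists_monoidHom_of_gram_smul hgram hspan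
  have hmem : ∀ k, ρ k ∈ orthogonalSymmetries (Set.range v) := by
    intro k
    rw [mem_orthogonalSymmetries, ← Set.range_comp]
    have : (ρ k) ∘ v = v ∘ fun x => k • x := funext fun x => hρ k x
    rw [this, (MulAction.surjective k).range_comp]
  let ρ' : K →* orthogonalSymmetries (Set.range v) := ρ.codRestrict _ hmem
  refine ⟨MulEquiv.ofBijective ρ' ⟨?_, ?_⟩, hρ⟩
  · intro k l h
    refine FaithfulSMul.eq_of_smul_eq_smul (α := X) fun x => hv ?_
    rw [← hρ, ← hρ]
    exact congrArg (fun e : orthogonalSymmetries (Set.range v) => e.1 (v x)) h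
  · rintro ⟨e, he⟩
    rw [mem_orthogonalSymmetries] at he
    have h1 : ∀ x, ∃ y, v y = e (v x) := fun x => by
      have : e (v x) ∈ Set.range v := he ▸ ⟨v x, ⟨x, rfl⟩, rfl⟩
      exact this
    choose σ hσ using h1
    have hinj : Function.Injective σ := fun x y h => by
      have := hσ x
      rw [h, hσ] at this
      exact hv (e.injective this.symm)
    obtain ⟨k, hk⟩ := hall (Equiv.ofBijective σ (Finite.injective_iff_bijective.1 hinj))
      fun x y => by
        rw [Equiv.ofBijective_apply, Equiv.ofBijective_apply, hσ, hσ, e.inner_map_map]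
    refine ⟨k, Subtype.ext (linearIsometryEquiv_ext_of_span hspan fun x => ?_)⟩
    change ρ k (v x) = e (v x)
    rw [hρ, ← hk, ← hσ]
    rfl

/-- The vertices of a polytope inscribed in a sphere. -/
theorem extremePoints_convexHull_of_norm_eq {S : Set (Euc d)} {R : ℝ} (hS : ∀ y ∈ S, ‖y‖ = R) :
    (convexHull ℝ S).extremePoints ℝ = S := by
  refine extremePoints_convexHull_subset.antisymm fun y hy => ?_
  have hsub : S ⊆ Metric.closedBall 0 R := fun z hz => by
    rw [mem_closedBall_zero_iff, hS z hz]
  have hhull : convexHull ℝ S ⊆ Metric.closedBall 0 R :=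
    convexHull_min hsub (convex_closedBall 0 R)
  rcases eq_or_ne R 0 with rfl | hR
  · rw [Metric.closedBall_zero] at hhull
    exact ⟨subset_convexHull _ _ hy, fun x₁ h₁ _ _ _ => by
      rw [hhull h₁, norm_eq_zero.1 (hS y hy)]⟩
  -- A point of the sphere is extreme in the whole ball, hence in any smaller set that contains it.
  · exact inter_extremePoints_subset_extremePoints_of_subset hhull
      ⟨subset_convexHull _ _ hy, StrictConvexSpace.sphere_subset_extremePoints_closedBall 0 hR
        (mem_sphere_zero_iff_norm.2 (hS y hy))⟩

theorem image_extremePoints_isometryEquiv (e : Euc d ≃ᵢ Euc d) (S : Set (Euc d)) :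
    e '' S.extremePoints ℝ = (e '' S).extremePoints ℝ := by
  have hsub : ∀ (f : Euc d ≃ᵢ Euc d) (T : Set (Euc d)),
      f '' T.extremePoints ℝ ⊆ (f '' T).extremePoints ℝ := by
    rintro f T _ ⟨a, ha, rfl⟩
    refine ⟨⟨a, ha.1, rfl⟩, ?_⟩
    rintro _ ⟨x, hx, rfl⟩ _ ⟨y, hy, rfl⟩ h
    have hseg : f '' openSegment ℝ x y = openSegment ℝ (f x) (f y) := by
      have := image_openSegment ℝ f.toRealAffineIsometryEquiv.toAffineEquiv.toAffineMap x y
      simpa using this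
    rw [← hseg, f.injective.mem_set_image] at h
    rw [ha.2 hx hy h]
  refine (hsub e S).antisymm fun b hb => ?_
  have h := hsub e.symm (e '' S) ⟨b, hb, rfl⟩
  rw [← Set.image_comp, e.symm_comp_self, Set.image_id] at h
  exact ⟨e.symm b, h, e.apply_symm_apply b⟩

/-- The isometries of a polytope inscribed in a sphere about its vertex centroid are the symmetries
of its vertex set. -/
theorem nonempty_orthogonalSymmetries_mulEquiv_Iso {X : Type*} [Fintype X] [Nonempty X]
    {v : X → Euc d} (hv : Function.Injective v) {R : ℝ} (hR : ∀ x, ‖v x‖ = R)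
    (hsum : ∑ x, v x = 0) :
    Nonempty (orthogonalSymmetries (Set.range v) ≃* Iso (convexHull ℝ (Set.range v))) := by
  have hext : (convexHull ℝ (Set.range v)).extremePoints ℝ = Set.range v :=
    extremePoints_convexHull_of_norm_eq (R := R) (by rintro _ ⟨x, rfl⟩; exact hR x)
  let φ : orthogonalSymmetries (Set.range v) →* Iso (convexHull ℝ (Set.range v)) :=
    { toFun := fun e => ⟨e.1.toIsometryEquiv, by
        rw [mem_Iso]
        have := e.1.toLinearEquiv.toLinearMap.image_convexHull (Set.range v)
        have h2 := e.2
        rw [mem_orthogonalSymmetries] at h2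
        refine this.trans ?_
        congr 1⟩
      map_one' := rfl
      map_mul' := fun _ _ => rfl }
  refine ⟨MulEquiv.ofBijective φ ⟨fun e e' h => ?_, ?_⟩⟩
  · refine Subtype.ext (LinearIsometryEquiv.ext fun y => ?_)
    exact congrArg (fun f : Iso (convexHull ℝ (Set.range v)) => f.1 y) h
  · rintro ⟨e, he⟩
    have hrange : e '' Set.range v = Set.range v := by
      rw [← hext, image_extremePoints_isometryEquiv, mem_Iso.1 he]
    have h1 : ∀ x, ∃ y, v y = e (v x) := fun x => by
      have : e (v x) ∈ Set.range v := hrange ▸ ⟨v x, ⟨x, rfl⟩, rfl⟩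
      exact this
    choose σ hσ using h1
    have hinj : Function.Injective σ := fun x y h => by
      have := hσ x
      rw [h, hσ] at this
      exact hv (e.injective this.symm)
    have hbij := Finite.injective_iff_bijective.1 hinj
    have hlin : ∀ y, e y = e.toRealAffineIsometryEquiv.linearIsometryEquiv y + e 0 := fun y => by
      simpa using e.toRealAffineIsometryEquiv.map_vadd 0 y
    -- An isometry is affine and permutes the vertices, so it fixes their centroid, which is the
    -- origin.
    have h0 : e 0 = 0 := by
      have h2 : ∑ x, e (v x) = 0 := by
        simp only [← hσ]
        rw [← hsum]
        exact (Equiv.ofBijective σ hbij).sum_comp v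
      simp only [fun x => hlin (v x), Finset.sum_add_distrib, ← map_sum, hsum, map_zero,
        zero_add, Finset.sum_const, Finset.card_univ] at h2
      rw [← Nat.cast_smul_eq_nsmul ℝ] at h2
      exact (smul_eq_zero.1 h2).resolve_left (Nat.cast_ne_zero.2 Fintype.card_ne_zero)
    refine ⟨⟨e.toRealLinearIsometryEquivOfMapZero h0, ?_⟩, ?_⟩
    · rw [mem_orthogonalSymmetries]
      exact hrange
    · exact Subtype.ext (IsometryEquiv.ext fun y => rfl)

/-! ### From linear families to partition numbers. -/

theorem similar_image_add_left (P : Set (Euc d)) (c : Euc d) :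
    Similar P ((fun y => c + y) '' P) :=
  ⟨IsometryEquiv.addLeft c, 1, one_pos, by simp⟩

theorem canBePartitioned_of_mem_convexHull {N : ℕ} {G : Type*} {v : G → Euc d}
    {R : ℝ} (hR : ∀ g, ‖v g‖ = R) {x : Fin N → Euc d} {c : Euc d}
    {α : Fin N → G} (h : ∀ g, c + v g ∈ convexHull ℝ (x '' (α ⁻¹' {g}))) :
    CanBePartitioned x ((fun y => c + y) '' convexHull ℝ (Set.range v)) := by
  have hext : ((fun y => c + y) '' convexHull ℝ (Set.range v)).extremePoints ℝ =
      (fun y => c + y) '' Set.range v := by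
    have h1 := image_extremePoints_isometryEquiv (IsometryEquiv.addLeft c)
      (convexHull ℝ (Set.range v))
    rw [extremePoints_convexHull_of_norm_eq (R := R) (by rintro _ ⟨x, rfl⟩; exact hR x)] at h1
    exact h1.symm
  refine ⟨fun i => ⟨c + v (α i), hext ▸ ⟨v (α i), ⟨α i, rfl⟩, rfl⟩⟩, ?_⟩
  rintro ⟨w, hw⟩
  have hw' := hw
  rw [hext] at hw'
  obtain ⟨_, ⟨g, rfl⟩, rfl⟩ := hw'
  refine convexHull_mono (Set.image_mono fun i hi => ?_) (h g)
  rw [Set.mem_preimage, Set.mem_singleton_iff] at hi ⊢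
  subst hi
  rfl

/-- The partition number of a class that contains all polytopes with vertices `L u g`, with `u`
outside a closed null set. -/
theorem partitionNumber_le_of_linear_family {N : ℕ} {G : Type*} [Fintype G]
    (L : Euc d →ₗ[ℝ] (G → Euc d)) (hL : Function.Injective (configuration L))
    (hG : 2 ≤ Fintype.card G) (hN : N + 2 * d = (d + 1) * Fintype.card G) {B : Set (Euc d)}
    (hB : IsClosed B) (hB0 : volume B = 0) {C : Set (Set (Euc d))}
    (hC : ∀ u ∉ B, (∃ R, ∀ g, ‖L u g‖ = R) ∧
      convexHull ℝ (Set.range (L u)) ∈ C) :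
    partitionNumber C ≤ N := by
  classical
  refine iInf₂_le N ?_
  obtain ⟨U, hU, hU', hU0, h⟩ := generic_exists_configuration L hL hG hN hB hB0
  refine ⟨U, hU, hU', hU0, fun x hx => ?_⟩
  obtain ⟨u, hu, c, α, hα⟩ := h x hx
  obtain ⟨⟨R, hR⟩, hP⟩ := hC u hu
  exact ⟨_, hP, _, similar_image_add_left _ c, canBePartitioned_of_mem_convexHull hR hα⟩

/-! ### Zero sets of quadratic forms -/

/-- On each line in direction `w`, `q` is a polynomial of degree two with leading coefficient `q w`,
so it has finitely many zeros there. Fubini concludes. -/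
theorem volume_zeros_quadratic_eq_zero {d : ℕ} {q : Euc d → ℝ} (hq : Continuous q)
    (hexp : ∀ y w, ∃ b, ∀ t : ℝ, q (y + t • w) = q y + b * t + q w * t ^ 2)
    {w : Euc d} (hw : q w ≠ 0) : volume {u | q u = 0} = 0 := by
  have hclosed : IsClosed {u | q u = 0} := isClosed_eq hq continuous_const
  have h := ae_mem_of_ae_add_linearMap_mem (LinearMap.toSpanSingleton ℝ (Euc d) w) volume volume
    hclosed.measurableSet.compl fun y => ?_
  · simpa using compl_mem_ae_iff.1 h
  · obtain ⟨b, hb⟩ := hexp y w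
    have hfin : {t : ℝ | q (y + t • w) = 0}.Finite := by
      let p : Polynomial ℝ := Polynomial.C (q w) * Polynomial.X ^ 2 + Polynomial.C b * Polynomial.X +
        Polynomial.C (q y)
      have hp : p ≠ 0 := fun h0 => hw (by
        have := congrArg (fun p => Polynomial.coeff p 2) h0
        simpa [p, Polynomial.coeff_X, Polynomial.coeff_C] using this)
      refine (Polynomial.finite_setOfPred_isRoot hp).subset fun t ht => ?_
      have ht' : q (y + t • w) = 0 := ht
      rw [hb] at ht'
      change Polynomial.IsRoot p t
      simp only [Polynomial.IsRoot, p, Polynomial.eval_add, Polynomial.eval_mul,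
        Polynomial.eval_C, Polynomial.eval_pow, Polynomial.eval_X]
      linarith
    filter_upwards [hfin.countable.ae_notMem volume] with t ht
    exact ht

/-! ### Orthogonal maps of `ℝ³` with the same quadratic form -/

/-- A skew 3×3 matrix is determined up to sign by its square. Here p, q, r are its entries above the
diagonal, and the hypotheses compare the entries of the squares. -/
theorem eq_or_eq_neg_of_skew_of_sq_eq {p q r p' q' r' : ℝ} (h11 : p ^ 2 + q ^ 2 = p' ^ 2 + q' ^ 2)
    (h22 : p ^ 2 + r ^ 2 = p' ^ 2 + r' ^ 2) (h33 : q ^ 2 + r ^ 2 = q' ^ 2 + r' ^ 2)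
    (h12 : q * r = q' * r') (h13 : p * r = p' * r') (h23 : p * q = p' * q') :
    (p' = p ∧ q' = q ∧ r' = r) ∨ (p' = -p ∧ q' = -q ∧ r' = -r) := by
  have hp : (p' - p) * (p' + p) = 0 := by linarith
  have hq : (q' - q) * (q' + q) = 0 := by linarith
  have hr : (r' - r) * (r' + r) = 0 := by linarith
  grind

/-- For orthogonal M, (M - Mᵀ)² = (M + Mᵀ)² - 4. The symmetric part therefore determines the square
of the skew part, and in dimension three the skew part itself up to sign; changing the sign amounts
to transposing. -/
theorem orthogonal_eq_or_eq_transpose {A B : Matrix (Fin 3) (Fin 3) ℝ}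
    (hA : A.transpose * A = 1) (hB : B.transpose * B = 1)
    (h : ∀ i j, A i j + A j i = B i j + B j i) : B = A ∨ B = A.transpose := by
  have hA' := mul_eq_one_comm.1 hA
  have hB' := mul_eq_one_comm.1 hB
  have hS : A + A.transpose = B + B.transpose := by
    ext i j
    exact h i j
  have hsq : ∀ M : Matrix (Fin 3) (Fin 3) ℝ, M.transpose * M = 1 → M * M.transpose = 1 →
      (M - M.transpose) * (M - M.transpose) = (M + M.transpose) * (M + M.transpose) - 4 := by
    intro M h1 h2
    have : (M - M.transpose) * (M - M.transpose) = (M + M.transpose) * (M + M.transpose)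
        - (2 * (M * M.transpose) + 2 * (M.transpose * M)) := by noncomm_ring
    rw [this, h1, h2]
    norm_num
  have hK : (A - A.transpose) * (A - A.transpose) = (B - B.transpose) * (B - B.transpose) := by
    rw [hsq A hA hA', hsq B hB hB', hS]
  have hK' : ∀ i j, ((A - A.transpose) * (A - A.transpose)) i j =
      ((B - B.transpose) * (B - B.transpose)) i j := fun i j => by rw [hK]
  simp only [Matrix.mul_apply, Fin.sum_univ_three, Matrix.sub_apply, Matrix.transpose_apply]
    at hK'
  have h00 := hK' 0 0
  have h11 := hK' 1 1
  have h22 := hK' 2 2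
  have h01 := hK' 0 1
  have h02 := hK' 0 2
  have h12 := hK' 1 2
  have d0 := h 0 0
  have d1 := h 1 1
  have d2 := h 2 2
  have s01 := h 0 1
  have s02 := h 0 2
  have s12 := h 1 2
  rcases eq_or_eq_neg_of_skew_of_sq_eq (p := A 0 1 - A 1 0) (q := A 0 2 - A 2 0)
    (r := A 1 2 - A 2 1) (p' := B 0 1 - B 1 0) (q' := B 0 2 - B 2 0) (r' := B 1 2 - B 2 1)
    (by linarith) (by linarith) (by linarith) (by linarith) (by linarith) (by linarith)
    with ⟨e1, e2, e3⟩ | ⟨e1, e2, e3⟩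
  · left
    ext i j
    fin_cases i <;> fin_cases j <;> simp <;> linarith
  · right
    ext i j
    fin_cases i <;> fin_cases j <;> simp <;> linarith

/-- By polarization the quadratic form of an orthogonal map is the symmetric part of its matrix, and
the transpose is the inverse. -/
theorem eq_or_eq_inv_of_inner_eq {a b : Euc 3 ≃ₗᵢ[ℝ] Euc 3}
    (h : ∀ u, inner ℝ u (a u) = inner ℝ u (b u)) : b = a ∨ b = a⁻¹ := by
  let e : Fin 3 → Euc 3 := fun i => EuclideanSpace.single i 1
  have he : ∀ i (y : Euc 3), inner ℝ (e i) y = y i := fun i y => by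
    simp [e, EuclideanSpace.inner_single_left]
  have hspan : Submodule.span ℝ (Set.range e) = ⊤ := by
    have := (EuclideanSpace.basisFun (Fin 3) ℝ).toBasis.span_eq
    rw [← this]
    congr 2
    ext i : 1
    simp [e]
  let M : (Euc 3 ≃ₗᵢ[ℝ] Euc 3) → Matrix (Fin 3) (Fin 3) ℝ := fun f => Matrix.of fun i j => f (e j) i
  have hM : ∀ f, (M f).transpose * M f = 1 := by
    intro f
    ext i j
    have h1 : inner ℝ (f (e i)) (f (e j)) = (1 : Matrix (Fin 3) (Fin 3) ℝ) i j := by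
      rw [f.inner_map_map, he]
      simp [e, Matrix.one_apply]
    rw [← h1, PiLp.inner_apply]
    simp [Matrix.mul_apply, M, mul_comm]
  have hpol : ∀ i j, M a i j + M a j i = M b i j + M b j i := by
    intro i j
    have h1 := h (e i + e j)
    have h2 := h (e i)
    have h3 := h (e j)
    simp only [map_add, inner_add_left, inner_add_right, he] at h1 h2 h3
    simp only [M, Matrix.of_apply]
    linarith
  rcases orthogonal_eq_or_eq_transpose (hM a) (hM b) hpol with h1 | h1
  · left
    refine linearIsometryEquiv_ext_of_span hspan fun j => ?_
    ext i
    exact congrFun (congrFun h1 i) j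
  · right
    refine linearIsometryEquiv_ext_of_span hspan fun j => ?_
    ext i
    have h2 : b (e j) i = a (e i) j := congrFun (congrFun h1 i) j
    rw [h2, ← he, ← he i]
    change inner ℝ (e j) (a (e i)) = inner ℝ (e i) (a.symm (e j))
    rw [real_inner_comm, ← a.inner_map_map (e i), a.apply_symm_apply]

/-! ### Rigidity of Cayley graphs up to inversion -/

/-- No element of order greater than two can be inverted by a permutation of the group that
preserves all quotients up to inversion. -/
def InversionRigid (H : Type*) [Group H] : Prop :=
  ∀ g : H, g * g ≠ 1 → ∃ h : H, g * h * g⁻¹ ≠ h⁻¹ ∧ g * g ≠ h * h ∧ g * h ≠ h * g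

theorem InversionRigid.of_mulEquiv {H K : Type*} [Group H] [Group K] (hH : InversionRigid H)
    (e : H ≃* K) : InversionRigid K := by
  intro g hg
  obtain ⟨h, h1, h2, h3⟩ := hH (e.symm g) fun h => hg (e.symm.injective (by rw [map_mul, h, map_one]))
  refine ⟨e h, fun h' => h1 ?_, fun h' => h2 ?_, fun h' => h3 ?_⟩ <;>
  · have := congrArg e.symm h'
    simpa using this

theorem InversionRigid.prod {H A : Type*} [Group H] [CommGroup A] (hH : InversionRigid H)
    (hA : ∀ a : A, a * a = 1) : InversionRigid (H × A) := by
  rintro ⟨g, a⟩ hg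
  obtain ⟨h, h1, h2, h3⟩ := hH g fun h => hg (Prod.ext h (hA a))
  exact ⟨(h, 1), fun h' => h1 (congrArg Prod.fst h'), fun h' => h2 (congrArg Prod.fst h'),
    fun h' => h3 (congrArg Prod.fst h')⟩

/-- After normalizing to fix 1, the map sends each x to x or x⁻¹. If some g with g² ≠ 1 were
inverted, comparing g with the witness `h` would leave four cases: g² = 1 and the three relations
that `h` excludes. -/
theorem InversionRigid.exists_eq_mul {H : Type*} [Group H] (hH : InversionRigid H) {σ : H → H}
    (hσ : ∀ g h, (σ g)⁻¹ * σ h = g⁻¹ * h ∨ (σ g)⁻¹ * σ h = h⁻¹ * g) :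
    ∃ k, ∀ x, σ x = k * x := by
  refine ⟨σ 1, fun g => ?_⟩
  obtain ⟨f, hf⟩ : ∃ f : H → H, ∀ x, σ x = σ 1 * f x := ⟨fun x => (σ 1)⁻¹ * σ x, fun x => by simp⟩
  have h1 : ∀ x, f x = x ∨ f x = x⁻¹ := fun x => by
    have := hσ 1 x
    rw [hf x] at this
    simpa using this
  have h2 : ∀ x y, (f x)⁻¹ * f y = x⁻¹ * y ∨ (f x)⁻¹ * f y = y⁻¹ * x := fun x y => by
    have := hσ x y
    rw [hf x, hf y] at this
    simpa [mul_assoc] using this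
  rw [hf g]
  congr 1
  by_contra hg
  have hg' : f g = g⁻¹ := (h1 g).resolve_left hg
  have hgg : g * g ≠ 1 := fun h => hg (by rw [hg', inv_eq_of_mul_eq_one_left h])
  obtain ⟨h, n1, n2, n3⟩ := hH g hgg
  have h3 := h2 g h
  rw [hg', inv_inv] at h3
  rcases h1 h with hh | hh <;> rw [hh] at h3 <;> rcases h3 with h3 | h3
  · exact hgg (by rw [mul_eq_one_iff_eq_inv]; exact mul_right_cancel h3)
  · exact n1 (by rw [h3, mul_inv_cancel_right])
  · apply n2
    calc g * g = g * (g * h⁻¹) * h := by group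
      _ = h * h := by rw [h3]; group
  · apply n3
    calc g * h = h * (h⁻¹ * g) * h := by group
      _ = h * g := by rw [← h3]; group

/-! ### Generic orbits -/

/-- The half-turn about a coordinate axis. -/
noncomputable def halfTurn (i : Fin 3) : Euc 3 ≃ₗᵢ[ℝ] Euc 3 :=
  LinearIsometryEquiv.piLpCongrRight 2 fun j =>
    if j = i then LinearIsometryEquiv.refl ℝ ℝ else LinearIsometryEquiv.neg ℝ

@[simp]
theorem halfTurn_apply (i : Fin 3) (u : Euc 3) (j : Fin 3) :
    halfTurn i u j = if j = i then u j else -u j := by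
  simp only [halfTurn, LinearIsometryEquiv.piLpCongrRight_apply]
  split_ifs <;> rfl

theorem eq_zero_of_forall_halfTurn_eq {u : Euc 3} (h : ∀ i, halfTurn i u = u) : u = 0 := by
  have h1 : ∀ i j, j ≠ i → u j = 0 := fun i j hij => by
    have := congrArg (fun y : Euc 3 => y j) (h i)
    simp only [halfTurn_apply, if_neg hij] at this
    linarith
  ext j
  fin_cases j
  · exact h1 1 0 (by decide)
  · exact h1 0 1 (by decide)
  · exact h1 0 2 (by decide)

/-- The vectors that lie in a coordinate plane or at which two elements of `G` that are not equal
up to inversion give the same angle. -/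
def degenerateVectors (G : Subgroup (Euc 3 ≃ₗᵢ[ℝ] Euc 3)) : Set (Euc 3) :=
  (⋃ i : Fin 3, {u | u i = 0}) ∪
    ⋃ p ∈ {p : G × G | p.2 ≠ p.1 ∧ p.2 ≠ p.1⁻¹},
      {u | inner ℝ u (p.1.1 u) - inner ℝ u (p.2.1 u) = 0}

theorem isClosed_degenerateVectors (G : Subgroup (Euc 3 ≃ₗᵢ[ℝ] Euc 3)) [Finite G] :
    IsClosed (degenerateVectors G) := by
  refine (isClosed_iUnion_of_finite fun i => isClosed_eq (by fun_prop) continuous_const).union ?_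
  refine (Set.toFinite _).isClosed_biUnion fun p _ => isClosed_eq ?_ continuous_const
  have := p.1.1.continuous
  have := p.2.1.continuous
  fun_prop

/-- Each piece is the zero set of a quadratic form. For a pair of group elements the form does not
vanish identically, as otherwise the two would be equal or inverse to each other. -/
theorem volume_degenerateVectors (G : Subgroup (Euc 3 ≃ₗᵢ[ℝ] Euc 3)) [Finite G] :
    volume (degenerateVectors G) = 0 := by
  refine measure_union_null (measure_iUnion_null fun i => ?_)
    ((measure_biUnion_null_iff (Set.to_countable _)).2 fun p hp => ?_)
  · have h := volume_zeros_quadratic_eq_zero (q := fun u : Euc 3 => u i ^ 2) (by fun_prop)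
      (fun y w => ⟨2 * y i * w i, fun t => by simp; ring⟩)
      (w := EuclideanSpace.single i 1) (by simp)
    simpa using h
  · obtain ⟨w, hw⟩ : ∃ w, inner ℝ w (p.1.1 w) - inner ℝ w (p.2.1 w) ≠ 0 := by
      by_contra! hcon
      rcases eq_or_eq_inv_of_inner_eq fun u => sub_eq_zero.1 (hcon u) with h | h
      · exact hp.1 (Subtype.ext h)
      · exact hp.2 (Subtype.ext h)
    have := p.1.1.continuous
    have := p.2.1.continuous
    refine volume_zeros_quadratic_eq_zero (by fun_prop) (fun y w =>
      ⟨inner ℝ y (p.1.1 w) + inner ℝ w (p.1.1 y) - (inner ℝ y (p.2.1 w) + inner ℝ w (p.2.1 y)),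
        fun t => ?_⟩) hw
    simp only [map_add, map_smul, inner_add_left, inner_add_right, real_inner_smul_left,
      real_inner_smul_right]
    ring

theorem eq_or_eq_inv_of_notMem_degenerateVectors {G : Subgroup (Euc 3 ≃ₗᵢ[ℝ] Euc 3)} {u : Euc 3}
    (hu : u ∉ degenerateVectors G) {a b : Euc 3 ≃ₗᵢ[ℝ] Euc 3} (ha : a ∈ G) (hb : b ∈ G)
    (h : inner ℝ u (a u) = inner ℝ u (b u)) : b = a ∨ b = a⁻¹ := by
  by_contra! hcon
  refine hu (Or.inr (Set.mem_biUnion (x := ((⟨a, ha⟩ : G), (⟨b, hb⟩ : G))) ⟨?_, ?_⟩ (sub_eq_zero.2 h)))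
  · exact fun h => hcon.1 (congrArg Subtype.val h)
  · exact fun h => hcon.2 (congrArg Subtype.val h)

theorem trivialStabilizer_of_notMem_degenerateVectors {G : Subgroup (Euc 3 ≃ₗᵢ[ℝ] Euc 3)}
    {u : Euc 3} (hu : u ∉ degenerateVectors G) : TrivialStabilizer G u := by
  intro g hg h
  rcases eq_or_eq_inv_of_notMem_degenerateVectors hu (one_mem G) hg
    (by rw [h]; rfl) with h | h
  · exact h
  · rw [h, inv_one]

/-- The sum of `u` and its image under the i-th half-turn is 2 uᵢ eᵢ. -/
theorem span_orbit_eq_top {H : Subgroup (Euc 3 ≃ₗᵢ[ℝ] Euc 3)} (hV : ∀ i, halfTurn i ∈ H)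
    {u : Euc 3} (hu : ∀ i, u i ≠ 0) :
    Submodule.span ℝ (Set.range fun g : H => g.1 u) = ⊤ := by
  set W := Submodule.span ℝ (Set.range fun g : H => g.1 u)
  have hmem : ∀ g ∈ H, g u ∈ W := fun g hg => Submodule.subset_span ⟨⟨g, hg⟩, rfl⟩
  have hi : ∀ i, EuclideanSpace.single i (1 : ℝ) ∈ W := by
    intro i
    have h1 := W.smul_mem (2 * u i)⁻¹ (W.add_mem (hmem 1 (one_mem H)) (hmem _ (hV i)))
    convert h1 using 1
    ext j
    have h2 : (1 : Euc 3 ≃ₗᵢ[ℝ] Euc 3) u j = u j := rfl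
    simp only [PiLp.smul_apply, PiLp.add_apply, halfTurn_apply, h2, PiLp.single_apply, smul_eq_mul]
    split_ifs with hj
    · subst hj
      have := hu j
      field_simp
      ring
    · ring
  rw [eq_top_iff, ← (EuclideanSpace.basisFun (Fin 3) ℝ).toBasis.span_eq, Submodule.span_le]
  rintro _ ⟨i, rfl⟩
  simpa using hi i

/-- The isometry group of a generic orbit polytope is the group itself. -/
theorem nonempty_mulEquiv_Iso_orbitPolytope {G H : Subgroup (Euc 3 ≃ₗᵢ[ℝ] Euc 3)} [Finite G]
    (hHG : H ≤ G) (hV : ∀ i, halfTurn i ∈ H) (hH : InversionRigid H) {u : Euc 3}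
    (hu : u ∉ degenerateVectors G) : Nonempty (H ≃* Iso (orbitPolytope H u)) := by
  have : Finite H := Finite.of_injective _ (Subgroup.inclusion_injective hHG)
  have := Fintype.ofFinite H
  have htriv := trivialStabilizer_of_notMem_degenerateVectors hu
  have hu0 : ∀ i, u i ≠ 0 := fun i h => hu (Or.inl (Set.mem_iUnion.2 ⟨i, h⟩))
  let v : H → Euc 3 := fun g => g.1 u
  have hquot : ∀ g h : H, inner ℝ (v g) (v h) = inner ℝ u ((g⁻¹ * h).1 u) := fun g h => by
    rw [← g.1.inner_map_map u]
    change _ = inner ℝ (g.1 u) ((g * (g⁻¹ * h)).1 u)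
    rw [mul_inv_cancel_left]
  have hv : Function.Injective v := fun g h hgh => by
    have h1 : (g⁻¹ * h).1 = 1 := by
      refine htriv _ (hHG (g⁻¹ * h).2) ?_
      change g.1.symm (v h) = u
      rw [← hgh]
      exact g.1.symm_apply_apply u
    exact (inv_mul_eq_one.1 (Subtype.ext h1 : g⁻¹ * h = 1))
  have hspan : Submodule.span ℝ (Set.range v) = ⊤ := span_orbit_eq_top hV hu0
  obtain ⟨Ψ, -⟩ := exists_mulEquiv_orthogonalSymmetries (K := H) hv (fun k x y => by
    rw [hquot, hquot, smul_eq_mul, smul_eq_mul]; group) hspan fun σ hσ => by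
      refine hH.exists_eq_mul fun g h => ?_
      have h1 := hσ g h
      rw [hquot, hquot] at h1
      rcases eq_or_eq_inv_of_notMem_degenerateVectors hu (hHG ((σ g)⁻¹ * σ h).2)
        (hHG (g⁻¹ * h).2) h1 with h2 | h2
      · exact Or.inl (Subtype.ext h2.symm)
      · right
        have h3 : g⁻¹ * h = ((σ g)⁻¹ * σ h)⁻¹ := Subtype.ext h2
        rw [← inv_inv ((σ g)⁻¹ * σ h), ← h3, mul_inv_rev, inv_inv]
  -- The orbit sum is invariant under the three half-turns, whose only common fixed vector is 0.
  have hsum : ∑ g, v g = 0 := by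
    refine eq_zero_of_forall_halfTurn_eq fun i => ?_
    rw [map_sum]
    exact Equiv.sum_comp (Equiv.mulLeft (⟨halfTurn i, hV i⟩ : H)) v
  obtain ⟨Θ⟩ := nonempty_orthogonalSymmetries_mulEquiv_Iso hv (R := ‖u‖)
    (fun g => g.1.norm_map u) hsum
  have horb : orbitPolytope H u = convexHull ℝ (Set.range v) := by
    rw [orbitPolytope]
    congr 1
    ext y
    exact ⟨fun ⟨g, hg, h⟩ => ⟨⟨g, hg⟩, h.symm⟩, fun ⟨g, h⟩ => ⟨g.1, g.2, h.symm⟩⟩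
  rw [horb]
  exact ⟨Ψ.trans Θ⟩

/-- The orbit map of a group of orthogonal maps. -/
noncomputable def orbitMap {d : ℕ} (H : Subgroup (Euc d ≃ₗᵢ[ℝ] Euc d)) : Euc d →ₗ[ℝ] (H → Euc d) where
  toFun u g := g.1 u
  map_add' u w := by ext g : 1; simp
  map_smul' t u := by ext g : 1; simp

theorem injective_configuration_orbitMap {H : Subgroup (Euc 3 ≃ₗᵢ[ℝ] Euc 3)}
    (hV : ∀ i, halfTurn i ∈ H) : Function.Injective (configuration (orbitMap H)) := by
  rw [← LinearMap.ker_eq_bot, LinearMap.ker_eq_bot']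
  rintro ⟨c, u⟩ h
  have h1 : ∀ g : H, c + g.1 u = 0 := fun g => congrFun h g
  have h2 : c + u = 0 := h1 1
  have hu : u = 0 := eq_zero_of_forall_halfTurn_eq fun i => by
    have h3 := h1 ⟨_, hV i⟩
    rw [← h2] at h3
    exact add_left_cancel h3
  subst hu
  rw [add_zero] at h2
  rw [h2]
  rfl

/-- The common bound for permutahedra (`H = G`) and alternahedra (`H` the rotations in `G`).
Degeneracy is measured in `G` because also for alternahedra the stabilizer must be trivial in the
full group. -/
theorem partitionNumber_orbitPolytope_le {G H : Subgroup (Euc 3 ≃ₗᵢ[ℝ] Euc 3)} [Finite G]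
    (hHG : H ≤ G) (hV : ∀ i, halfTurn i ∈ H) {K : Type} [Group K] (hK : InversionRigid K)
    (e : K ≃* H) {C : Set (Set (Euc 3))}
    (hC : ∀ u, TrivialStabilizer G u → orbitPolytope H u ∈ C) {N : ℕ}
    (hN : N + 6 = 4 * Nat.card K) : partitionNumber (withIso C K) ≤ N := by
  have : Finite H := Finite.of_injective _ (Subgroup.inclusion_injective hHG)
  have := Fintype.ofFinite H
  have hcard : Nat.card K = Fintype.card H := by
    rw [Nat.card_congr e.toEquiv, Nat.card_eq_fintype_card]
  refine partitionNumber_le_of_linear_family (orbitMap H) (injective_configuration_orbitMap hV)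
    (by omega) (by omega) (isClosed_degenerateVectors G) (volume_degenerateVectors G)
    fun u hu => ⟨⟨‖u‖, fun g => g.1.norm_map u⟩, ?_⟩
  have horb : convexHull ℝ (Set.range (orbitMap H u)) = orbitPolytope H u := by
    rw [orbitPolytope]
    congr 1
    ext y
    exact ⟨fun ⟨g, h⟩ => ⟨g.1, g.2, h.symm⟩, fun ⟨g, hg, h⟩ => ⟨⟨g, hg⟩, h.symm⟩⟩
  rw [horb]
  refine ⟨hC u (trivialStabilizer_of_notMem_degenerateVectors hu), ?_⟩
  obtain ⟨Θ⟩ := nonempty_mulEquiv_Iso_orbitPolytope hHG hV (hK.of_mulEquiv e) hu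
  exact ⟨(e.trans Θ).symm⟩

/-! ### Prisms and antiprisms -/

section Axial

variable {A : Type*} [AddCommGroup A] (χ : AddChar A Circle) (ε : AddChar A ℤˣ)

/-- The orbit of `u` under the group that acts on the plane through `χ` and on the axis through
`ε`. -/
noncomputable def axialMap : Euc 3 →ₗ[ℝ] (A → Euc 3) where
  toFun u a := !₂[(χ a : ℂ).re * u 0 - (χ a : ℂ).im * u 1,
    (χ a : ℂ).re * u 1 + (χ a : ℂ).im * u 0, ((ε a : ℤ) : ℝ) * u 2]
  map_add' u w := by
    ext a i
    fin_cases i <;> simp <;> ring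
  map_smul' t u := by
    ext a i
    fin_cases i <;> simp <;> ring

theorem axialMap_apply (u : Euc 3) (a : A) :
    axialMap χ ε u a = !₂[(χ a : ℂ).re * u 0 - (χ a : ℂ).im * u 1,
      (χ a : ℂ).re * u 1 + (χ a : ℂ).im * u 0, ((ε a : ℤ) : ℝ) * u 2] := rfl

/-- The Gram function of `axialMap`. -/
noncomputable def axialGram (u : Euc 3) (a : A) : ℝ :=
  (χ a : ℂ).re * (u 0 ^ 2 + u 1 ^ 2) + ((ε a : ℤ) : ℝ) * u 2 ^ 2

theorem inner_axialMap (u : Euc 3) (a b : A) :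
    inner ℝ (axialMap χ ε u a) (axialMap χ ε u b) = axialGram χ ε u (a - b) := by
  have h1 : ((χ (a - b) : Circle) : ℂ).re = (χ a : ℂ).re * (χ b : ℂ).re +
      (χ a : ℂ).im * (χ b : ℂ).im := by
    rw [AddChar.map_sub_eq_div, div_eq_mul_inv, Circle.coe_mul, Circle.coe_inv_eq_conj]
    simp
  have h2 : (((ε (a - b) : ℤˣ) : ℤ) : ℝ) = ((ε a : ℤ) : ℝ) * ((ε b : ℤ) : ℝ) := by
    rw [AddChar.map_sub_eq_div, div_eq_mul_inv, Int.units_inv_eq_self]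
    push_cast
    rfl
  rw [axialGram, h1, h2, axialMap_apply, axialMap_apply, PiLp.inner_apply]
  simp [Fin.sum_univ_three]
  ring

theorem re_sq_add_im_sq_circle (z : Circle) : (z : ℂ).re ^ 2 + (z : ℂ).im ^ 2 = 1 := by
  have := Circle.normSq_coe z
  rw [Complex.normSq_apply] at this
  linarith

theorem norm_axialMap (u : Euc 3) (a : A) :
    ‖axialMap χ ε u a‖ = √(axialGram χ ε u 0) := by
  rw [norm_eq_sqrt_real_inner, inner_axialMap, sub_self]

variable {χ ε}

/-- A vector orthogonal to the images at 0, a₁ and -a₁ vanishes. With P and Q the inner and the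
cross product of the planar parts, the three equations read P + u₂w₂ = 0 and cP ± sQ - u₂w₂ = 0,
whence sQ = 0 and (1 + c)P = 0. -/
theorem span_axialMap {a₁ : A} (hε : ε a₁ = -1) (hχ : (χ a₁ : ℂ).im ≠ 0) {u : Euc 3}
    (h0 : u 0 ≠ 0) (h2 : u 2 ≠ 0) : Submodule.span ℝ (Set.range (axialMap χ ε u)) = ⊤ := by
  rw [← Submodule.orthogonal_eq_bot_iff, Submodule.eq_bot_iff]
  intro w hw
  have hw' : ∀ a, inner ℝ (axialMap χ ε u a) w = 0 := fun a =>
    (Submodule.mem_orthogonal _ _).1 hw _ (Submodule.subset_span ⟨a, rfl⟩)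
  have e0 := hw' 0
  have e1 := hw' a₁
  have e2 := hw' (-a₁)
  have hcs := re_sq_add_im_sq_circle (χ a₁)
  simp only [axialMap_apply, PiLp.inner_apply, Fin.sum_univ_three, AddChar.map_zero_eq_one,
    AddChar.map_neg_eq_inv, hε, Circle.coe_inv_eq_conj, Circle.coe_one] at e0 e1 e2
  simp at e0 e1 e2
  set c := (χ a₁ : ℂ).re
  set s := (χ a₁ : ℂ).im
  have hq : u 0 * w 1 - u 1 * w 0 = 0 := by
    have : s * (u 0 * w 1 - u 1 * w 0) = 0 := by linarith
    exact (mul_eq_zero.1 this).resolve_left hχ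
  have hc : 1 + c ≠ 0 := fun h => hχ (by
    have h3 : c = -1 := by linarith
    rw [h3] at hcs
    exact pow_eq_zero_iff two_ne_zero |>.1 (by linarith))
  have hp : u 0 * w 0 + u 1 * w 1 = 0 := by
    have : (1 + c) * (u 0 * w 0 + u 1 * w 1) = 0 := by linarith
    exact (mul_eq_zero.1 this).resolve_left hc
  have hsq : u 0 ^ 2 + u 1 ^ 2 ≠ 0 := by positivity
  have w0 : w 0 = 0 := by
    have : (u 0 ^ 2 + u 1 ^ 2) * w 0 = 0 := by linear_combination u 0 * hp - u 1 * hq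
    exact (mul_eq_zero.1 this).resolve_left hsq
  have w1 : w 1 = 0 := by
    have : (u 0 ^ 2 + u 1 ^ 2) * w 1 = 0 := by linear_combination u 1 * hp + u 0 * hq
    exact (mul_eq_zero.1 this).resolve_left hsq
  have w2 : w 2 = 0 := by
    have : u 2 * w 2 = 0 := by linarith
    exact (mul_eq_zero.1 this).resolve_left h2
  ext i
  fin_cases i
  exacts [w0, w1, w2]

/-- This is (z - 1)(x + iy) = 0 in real coordinates, with z ≠ 1. -/
theorem eq_zero_of_circle_mul_eq {z : Circle} (hz : (z : ℂ).im ≠ 0) {x y : ℝ}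
    (hx : (z : ℂ).re * x - (z : ℂ).im * y = x) (hy : (z : ℂ).re * y + (z : ℂ).im * x = y) :
    x = 0 ∧ y = 0 := by
  set c := (z : ℂ).re
  set s := (z : ℂ).im
  have hpos : (c - 1) ^ 2 + s ^ 2 ≠ 0 := by positivity
  constructor
  · refine (mul_eq_zero.1 (?_ : ((c - 1) ^ 2 + s ^ 2) * x = 0)).resolve_left hpos
    linear_combination (c - 1) * hx + s * hy
  · refine (mul_eq_zero.1 (?_ : ((c - 1) ^ 2 + s ^ 2) * y = 0)).resolve_left hpos
    linear_combination (c - 1) * hy - s * hx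

theorem injective_configuration_axialMap {a₁ : A} (hε : ε a₁ = -1) (hχ : (χ a₁ : ℂ).im ≠ 0) :
    Function.Injective (configuration (axialMap χ ε)) := by
  rw [← LinearMap.ker_eq_bot, LinearMap.ker_eq_bot']
  rintro ⟨c, u⟩ h
  have h0 : c + axialMap χ ε u 0 = 0 := congrFun h 0
  have h1 : c + axialMap χ ε u a₁ = 0 := congrFun h a₁
  have h2 : axialMap χ ε u a₁ = axialMap χ ε u 0 := add_left_cancel (h1.trans h0.symm)
  have e : ∀ i, axialMap χ ε u a₁ i = axialMap χ ε u 0 i := fun i => by rw [h2]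
  have e0 := e 0
  have e1 := e 1
  have e2 := e 2
  simp [axialMap_apply, hε] at e0 e1 e2
  obtain ⟨z0, z1⟩ := eq_zero_of_circle_mul_eq hχ e0 e1
  have hu : u = 0 := by
    ext i
    fin_cases i
    exacts [z0, z1, by simpa using (by linarith : u 2 = 0)]
  subst hu
  rw [map_zero] at h0
  simp only [Pi.zero_apply, add_zero] at h0
  rw [h0]
  rfl

/-- Shifting by a₁ permutes the summands and acts on the sum by a linear map whose only fixed vector
is 0. -/
theorem sum_axialMap [Fintype A] {a₁ : A} (hε : ε a₁ = -1) (hχ : (χ a₁ : ℂ).im ≠ 0) (u : Euc 3) :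
    ∑ a, axialMap χ ε u a = 0 := by
  set S := ∑ a, axialMap χ ε u a with hS
  have hshift : ∑ a, axialMap χ ε u (a₁ + a) = S :=
    Equiv.sum_comp (Equiv.addLeft a₁) (axialMap χ ε u)
  have hval : ∀ a, axialMap χ ε u (a₁ + a) =
      !₂[(χ a₁ : ℂ).re * axialMap χ ε u a 0 - (χ a₁ : ℂ).im * axialMap χ ε u a 1,
        (χ a₁ : ℂ).re * axialMap χ ε u a 1 + (χ a₁ : ℂ).im * axialMap χ ε u a 0,
        -axialMap χ ε u a 2] := by
    intro a
    ext i
    fin_cases i <;> simp [axialMap_apply, AddChar.map_add_eq_mul, hε] <;> ring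
  have hi : ∀ i, S i = ∑ a, axialMap χ ε u a i := fun i => by rw [hS]; simp
  have hi' : ∀ i, S i = ∑ a, axialMap χ ε u (a₁ + a) i := fun i => by rw [← hshift]; simp
  have e0 := hi' 0
  have e1 := hi' 1
  have e2 := hi' 2
  simp only [hval] at e0 e1 e2
  simp [Finset.sum_add_distrib, Finset.sum_sub_distrib, ← Finset.mul_sum, ← hi] at e0 e1 e2
  obtain ⟨z0, z1⟩ := eq_zero_of_circle_mul_eq hχ e0.symm e1.symm
  ext i
  fin_cases i
  exacts [z0, z1, by simpa using (by linarith : S 2 = 0)]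

/-- In an abelian group inversion preserves quotients up to inversion, so it cannot be excluded. The
element a₁, of order greater than two, fixes one sign for all x. -/
theorem exists_add_or_sub_of_sub_eq_or {σ : A → A} {a₁ : A} (ha₁ : a₁ + a₁ ≠ 0)
    (hσ : ∀ x y, σ x - σ y = x - y ∨ σ x - σ y = -(x - y)) :
    ∃ c, (∀ x, σ x = c + x) ∨ ∀ x, σ x = c - x := by
  refine ⟨σ 0, ?_⟩
  have h0 : ∀ x, σ x = σ 0 + x ∨ σ x = σ 0 - x := fun x => by
    have := hσ x 0
    grind
  rcases h0 a₁ with h1 | h1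
  · left
    intro x
    rcases h0 x with h2 | h2
    · exact h2
    · have := hσ x a₁
      grind
  · right
    intro x
    rcases h0 x with h2 | h2
    · have := hσ x a₁
      grind
    · exact h2

variable (χ ε) in
/-- The vectors in two coordinate planes and those for which two elements of different parity
give the same angle. -/
def degenerateAxialVectors : Set (Euc 3) :=
  ({u | u 0 = 0} ∪ {u | u 2 = 0}) ∪
    ⋃ p ∈ {p : A × A | ε p.1 ≠ ε p.2}, {u | axialGram χ ε u p.1 - axialGram χ ε u p.2 = 0}

variable (χ ε) in
theorem isClosed_degenerateAxialVectors [Finite A] : IsClosed (degenerateAxialVectors χ ε) := by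
  refine ((isClosed_eq (by fun_prop) continuous_const).union
    (isClosed_eq (by fun_prop) continuous_const)).union ?_
  refine (Set.toFinite _).isClosed_biUnion fun p _ => isClosed_eq ?_ continuous_const
  simp only [axialGram]
  fun_prop

variable (χ ε) in
theorem volume_degenerateAxialVectors [Finite A] : volume (degenerateAxialVectors χ ε) = 0 := by
  have hcoord : ∀ i, volume {u : Euc 3 | u i = 0} = 0 := fun i => by
    have h := volume_zeros_quadratic_eq_zero (q := fun u : Euc 3 => u i ^ 2) (by fun_prop)
      (fun y w => ⟨2 * y i * w i, fun t => by simp; ring⟩)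
      (w := EuclideanSpace.single i 1) (by simp)
    simpa using h
  refine measure_union_null (measure_union_null (hcoord 0) (hcoord 2))
    ((measure_biUnion_null_iff (Set.to_countable _)).2 fun p hp => ?_)
  -- On the unit vector of the axis the form takes the value `ε p.1 - ε p.2`, which is nonzero for
  -- elements of different parity.
  refine volume_zeros_quadratic_eq_zero (w := EuclideanSpace.single 2 1) ?_ (fun y w =>
    ⟨((χ p.1 : ℂ).re - (χ p.2 : ℂ).re) * (2 * y 0 * w 0 + 2 * y 1 * w 1) +
      (((ε p.1 : ℤ) : ℝ) - ((ε p.2 : ℤ) : ℝ)) * (2 * y 2 * w 2), fun t => ?_⟩) ?_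
  · simp only [axialGram]
    fun_prop
  · simp only [axialGram, PiLp.add_apply, PiLp.smul_apply, smul_eq_mul]
    ring
  · have hp' : ((ε p.1 : ℤ) : ℝ) ≠ ((ε p.2 : ℤ) : ℝ) := fun h => hp (Units.ext (Int.cast_injective h))
    simpa [axialGram, sub_eq_zero] using hp'

/-- Off the degenerate set equal Gram values force equal parity, hence equal real parts of `χ`, and
two points of the circle with the same real part are equal or conjugate. -/
theorem eq_or_eq_neg_of_axialGram_eq (hinj : ∀ a b, χ a = χ b → ε a = ε b → a = b) {u : Euc 3}
    (hu : u ∉ degenerateAxialVectors χ ε) {a b : A} (h : axialGram χ ε u a = axialGram χ ε u b) :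
    a = b ∨ a = -b := by
  have hε : ε a = ε b := by
    by_contra hne
    exact hu (Or.inr (Set.mem_biUnion (x := (a, b)) hne (sub_eq_zero.2 h)))
  have hu0 : u 0 ≠ 0 := fun h => hu (Or.inl (Or.inl h))
  have hre : (χ a : ℂ).re = (χ b : ℂ).re := by
    rw [axialGram, axialGram, hε, add_left_inj] at h
    exact mul_right_cancel₀ (by positivity) h
  have h1 := re_sq_add_im_sq_circle (χ a)
  have h2 := re_sq_add_im_sq_circle (χ b)
  have him : ((χ a : ℂ).im - (χ b : ℂ).im) * ((χ a : ℂ).im + (χ b : ℂ).im) = 0 := by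
    rw [hre] at h1
    linarith
  rcases mul_eq_zero.1 him with him | him
  · exact Or.inl (hinj a b (Circle.ext (Complex.ext hre (by linarith))) hε)
  · refine Or.inr (hinj a (-b) (Circle.ext (Complex.ext ?_ ?_)) ?_)
    · rw [AddChar.map_neg_eq_inv, Circle.coe_inv_eq_conj, Complex.conj_re, hre]
    · rw [AddChar.map_neg_eq_inv, Circle.coe_inv_eq_conj, Complex.conj_im]
      linarith
    · rw [AddChar.map_neg_eq_inv, Int.units_inv_eq_self, hε]

/-- The Gram matrix depends on `u` only through u₀² + u₁² and u₂², so `u` may be turned into the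
plane u₁ = 0, reflected to positive height, and scaled to planar radius 1. -/
theorem exists_similar_axialMap {a₁ : A} (hε : ε a₁ = -1) (hχ : (χ a₁ : ℂ).im ≠ 0) {u : Euc 3}
    (h0 : u 0 ≠ 0) (h2 : u 2 ≠ 0) :
    ∃ h : ℝ, 0 < h ∧ Similar (convexHull ℝ (Set.range (axialMap χ ε !₂[1, 0, h])))
      (convexHull ℝ (Set.range (axialMap χ ε u))) := by
  have hsq : 0 < u 0 ^ 2 + u 1 ^ 2 := by positivity
  set ρ := √(u 0 ^ 2 + u 1 ^ 2) with hρ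
  have hρ0 : 0 < ρ := Real.sqrt_pos.2 hsq
  have hρ2 : ρ ^ 2 = u 0 ^ 2 + u 1 ^ 2 := Real.sq_sqrt hsq.le
  refine ⟨|u 2| / ρ, by positivity, ?_⟩
  set v := axialMap χ ε !₂[1, 0, |u 2| / ρ]
  obtain ⟨e, he⟩ := exists_linearIsometryEquiv_of_gram_eq (v := v)
    (v' := fun a => ρ⁻¹ • axialMap χ ε u a) (fun a b => by
      rw [real_inner_smul_left, real_inner_smul_right, inner_axialMap, inner_axialMap]
      simp only [axialGram, ← hρ2, Matrix.cons_val]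
      rw [div_pow, sq_abs]
      field_simp
      ring) (span_axialMap hε hχ (by simp) (by simp [h2, hρ0.ne']))
  refine ⟨e.toIsometryEquiv, ρ, hρ0, ?_⟩
  have h3 := (ρ • e.toLinearEquiv.toLinearMap).image_convexHull (Set.range v)
  have h4 : ⇑(ρ • e.toLinearEquiv.toLinearMap) '' Set.range v = Set.range (axialMap χ ε u) := by
    rw [← Set.range_comp]
    congr 1
    funext a
    change ρ • e (v a) = _
    rw [he, smul_inv_smul₀ hρ0.ne']
  rw [← h4, ← h3]
  rfl

/-- The hypotheses on `K` say that it acts faithfully as the group of all maps x ↦ c ± x; prisms and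
antiprisms differ only in `A`, `χ` and `ε`. -/
theorem partitionNumber_axial_le [Finite A] (hinj : ∀ a b, χ a = χ b → ε a = ε b → a = b)
    {a₁ : A} (hε : ε a₁ = -1) (hχ : (χ a₁ : ℂ).im ≠ 0) {K : Type} [Group K] [MulAction K A]
    [FaithfulSMul K A]
    (hK : ∀ k : K, ∃ c : A, (∀ x : A, k • x = c + x) ∨ ∀ x : A, k • x = c - x)
    (hadd : ∀ c : A, ∃ k : K, ∀ x : A, k • x = c + x)
    (hsub : ∀ c : A, ∃ k : K, ∀ x : A, k • x = c - x) {C : Set (Set (Euc 3))}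
    (hC : ∀ u : Euc 3, u 0 ≠ 0 → u 2 ≠ 0 → convexHull ℝ (Set.range (axialMap χ ε u)) ∈ C) {N : ℕ}
    (hN : N + 6 = 4 * Nat.card A) : partitionNumber (withIso C K) ≤ N := by
  have := Fintype.ofFinite A
  rw [Nat.card_eq_fintype_card] at hN
  refine partitionNumber_le_of_linear_family (axialMap χ ε)
    (injective_configuration_axialMap hε hχ) (by omega) (by omega)
    (isClosed_degenerateAxialVectors χ ε) (volume_degenerateAxialVectors χ ε)
    fun u hu => ⟨⟨_, norm_axialMap χ ε u⟩, ?_⟩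
  have hu0 : u 0 ≠ 0 := fun h => hu (Or.inl (Or.inl h))
  have hu2 : u 2 ≠ 0 := fun h => hu (Or.inl (Or.inr h))
  refine ⟨hC u hu0 hu2, ?_⟩
  -- If 2a₁ were 0, then `χ a₁` would be ±1, hence real.
  have ha₁ : a₁ + a₁ ≠ 0 := fun h => by
    have h1 : χ a₁ * χ a₁ = 1 := by rw [← AddChar.map_add_eq_mul, h, AddChar.map_zero_eq_one]
    have h2 := congrArg (fun z : Circle => (z : ℂ).im) h1
    have h3 := congrArg (fun z : Circle => (z : ℂ).re) h1
    have h4 := re_sq_add_im_sq_circle (χ a₁)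
    simp at h2 h3
    have : (χ a₁ : ℂ).im ^ 2 = 0 := by linarith
    exact hχ (pow_eq_zero_iff two_ne_zero |>.1 this)
  have hv : Function.Injective (axialMap χ ε u) := fun a b hab => by
    have h1 : axialGram χ ε u (a - b) = axialGram χ ε u 0 := by
      rw [← inner_axialMap, hab, inner_axialMap, sub_self]
    rcases eq_or_eq_neg_of_axialGram_eq hinj hu h1 with h2 | h2 <;> simpa [sub_eq_zero] using h2
  have hgram : ∀ (k : K) (x y : A), inner ℝ (axialMap χ ε u (k • x)) (axialMap χ ε u (k • y)) =
      inner ℝ (axialMap χ ε u x) (axialMap χ ε u y) := by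
    intro k x y
    obtain ⟨c, hc | hc⟩ := hK k
    · rw [inner_axialMap, inner_axialMap, hc, hc, add_sub_add_left_eq_sub]
    · rw [real_inner_comm, inner_axialMap, inner_axialMap, hc, hc, sub_sub_sub_cancel_left]
  obtain ⟨Ψ, -⟩ := exists_mulEquiv_orthogonalSymmetries (K := K) hv hgram
    (span_axialMap hε hχ hu0 hu2) fun σ hσ => by
      have h1 : ∀ x y, σ x - σ y = x - y ∨ σ x - σ y = -(x - y) := fun x y => by
        have := hσ x y
        rw [inner_axialMap, inner_axialMap] at this
        exact eq_or_eq_neg_of_axialGram_eq hinj hu this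
      obtain ⟨c, hc | hc⟩ := exists_add_or_sub_of_sub_eq_or ha₁ h1
      · obtain ⟨k, hk⟩ := hadd c
        exact ⟨k, fun x => by rw [hc, hk]⟩
      · obtain ⟨k, hk⟩ := hsub c
        exact ⟨k, fun x => by rw [hc, hk]⟩
  obtain ⟨Θ⟩ := nonempty_orthogonalSymmetries_mulEquiv_Iso hv (norm_axialMap χ ε u)
    (sum_axialMap hε hχ u)
  exact ⟨(Ψ.trans Θ).symm⟩

end Axial

/-! ### Dihedral actions on polygon, prism and antiprism vertices. -/

section Dihedral

variable {n : ℕ}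

/-- The dihedral group acts on the vertices of a regular polygon. -/
instance dihedralAction : MulAction (DihedralGroup n) (ZMod n) where
  smul g x := match g with
    | .r i => i + x
    | .sr i => -i - x
  one_smul x := zero_add x
  mul_smul g h x := by
    rcases g with i | i <;> rcases h with j | j
    · exact add_assoc i j x
    · change -(j - i) - x = i + (-j - x)
      ring
    · change -(i + j) - x = -i - (j + x)
      ring
    · change j - i + x = -i - (-j - x)
      ring

theorem r_smul (i x : ZMod n) : DihedralGroup.r i • x = i + x := rfl

theorem sr_smul (i x : ZMod n) : DihedralGroup.sr i • x = -i - x := rfl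

theorem dihedral_eq_of_smul_eq (hn : 3 ≤ n) {g h : DihedralGroup n}
    (hgh : ∀ x : ZMod n, g • x = h • x) : g = h := by
  have h2 : (2 : ZMod n) ≠ 0 := fun h => by
    have := (ZMod.natCast_eq_zero_iff 2 n).1 (by exact_mod_cast h)
    exact absurd (Nat.le_of_dvd two_pos this) (by omega)
  rcases g with i | i <;> rcases h with j | j <;>
    (have e0 := hgh 0; have e1 := hgh 1; simp only [r_smul, sr_smul] at e0 e1)
  · rw [add_zero, add_zero] at e0; rw [e0]
  · exact absurd (by linear_combination e1 - e0) h2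
  · exact absurd (by linear_combination e0 - e1) h2
  · rw [show i = j by linear_combination -e0]

/-- The symmetries of a prism act on its vertices. -/
instance prismAction :
    MulAction (DihedralGroup n × Multiplicative (ZMod 2)) (ZMod n × ZMod 2) where
  smul g x := (g.1 • x.1, g.2.toAdd + x.2)
  one_smul x := Prod.ext (one_smul _ x.1) (zero_add x.2)
  mul_smul g h x := Prod.ext (mul_smul g.1 h.1 x.1) (add_assoc _ _ _)

theorem prism_smul (g : DihedralGroup n × Multiplicative (ZMod 2)) (x : ZMod n × ZMod 2) :
    g • x = (g.1 • x.1, g.2.toAdd + x.2) := rfl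

/-- A real point of the circle squares to 1, which would make 2 = 0 modulo `n`. -/
theorem toCircle_one_im_ne_zero (hn : 3 ≤ n) [NeZero n] :
    ((ZMod.toCircle (1 : ZMod n) : Circle) : ℂ).im ≠ 0 := by
  intro h
  have h4 := re_sq_add_im_sq_circle (ZMod.toCircle (1 : ZMod n))
  rw [h] at h4
  have h1 : ZMod.toCircle (1 + 1 : ZMod n) = 1 := by
    rw [AddChar.map_add_eq_mul]
    apply Circle.ext
    apply Complex.ext <;> simp [h]
    linarith
  rw [← AddChar.map_zero_eq_one (ZMod.toCircle : AddChar (ZMod n) Circle)] at h1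
  have h2 := ZMod.injective_toCircle h1
  have := (ZMod.natCast_eq_zero_iff 2 n).1 (by norm_num at h2; exact_mod_cast h2)
  exact absurd (Nat.le_of_dvd two_pos this) (by omega)

theorem toCircle_natCast_re_im [NeZero n] (k : ℕ) :
    ((ZMod.toCircle (k : ZMod n) : Circle) : ℂ).re = Real.cos (2 * Real.pi * k / n) ∧
    ((ZMod.toCircle (k : ZMod n) : Circle) : ℂ).im = Real.sin (2 * Real.pi * k / n) := by
  have h : ((ZMod.toCircle (k : ZMod n) : Circle) : ℂ) =
      Complex.exp (((2 * Real.pi * k / n : ℝ) : ℂ) * Complex.I) := by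
    rw [ZMod.toCircle_natCast]
    congr 1
    push_cast
    ring
  rw [h]
  exact ⟨Complex.exp_ofReal_mul_I_re _, Complex.exp_ofReal_mul_I_im _⟩

/-! ### Prisms. -/

variable (n) in
/-- The character by which the vertices of a prism move around its axis. -/
noncomputable def prismRotation [NeZero n] : AddChar (ZMod n × ZMod 2) Circle :=
  ZMod.toCircle.compAddMonoidHom (AddMonoidHom.fst _ _)

variable (n) in
/-- The sign character of the two bases of a prism. -/
def prismSide : AddChar (ZMod n × ZMod 2) ℤˣ :=
  (AddChar.zmodChar 2 (ζ := (-1 : ℤˣ)) (by decide)).compAddMonoidHom (AddMonoidHom.snd _ _)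

theorem range_axialMap_prism [NeZero n] (h : ℝ) :
    Set.range (axialMap (prismRotation n) (prismSide n) !₂[1, 0, h]) =
      {v | ∃ (k : ℕ) (s : ℝ), (s = 1 ∨ s = -1) ∧
        v = !₂[Real.cos (2 * Real.pi * k / n), Real.sin (2 * Real.pi * k / n), s * h]} := by
  have hval : ∀ (k : ℕ) (s : ZMod 2),
      axialMap (prismRotation n) (prismSide n) !₂[1, 0, h] ((k : ZMod n), s) =
      !₂[Real.cos (2 * Real.pi * k / n), Real.sin (2 * Real.pi * k / n),
        (((AddChar.zmodChar 2 (ζ := (-1 : ℤˣ)) (by decide) s : ℤˣ) : ℤ) : ℝ) * h] := by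
    intro k s
    obtain ⟨h1, h2⟩ := toCircle_natCast_re_im (n := n) k
    simp [axialMap_apply, prismRotation, prismSide, h1, h2]
  ext v
  constructor
  · rintro ⟨⟨a, s⟩, rfl⟩
    obtain ⟨k, rfl⟩ := ZMod.natCast_zmod_surjective a
    refine ⟨k, _, ?_, hval k s⟩
    rcases Int.units_eq_one_or (AddChar.zmodChar 2 (ζ := (-1 : ℤˣ)) (by decide) s) with h | h <;>
      simp [h]
  · rintro ⟨k, s, rfl | rfl, rfl⟩
    · exact ⟨((k : ZMod n), 0), by rw [hval]; simp⟩
    · refine ⟨((k : ZMod n), 1), ?_⟩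
      have : AddChar.zmodChar 2 (ζ := (-1 : ℤˣ)) (by decide) 1 = -1 := by decide
      rw [hval, this]
      simp

theorem partitionNumber_prisms_le (hn : 3 ≤ n) :
    partitionNumber (withIso (rightRegularPrisms n)
      (DihedralGroup n × Multiplicative (ZMod 2))) ≤ ((8 * n - 6 : ℕ) : ℕ∞) := by
  have : NeZero n := ⟨by omega⟩
  have hside : prismSide n (1, 1) = -1 := rfl
  have hrot : ((prismRotation n (1, 1) : Circle) : ℂ).im ≠ 0 := toCircle_one_im_ne_zero hn
  have : FaithfulSMul (DihedralGroup n × Multiplicative (ZMod 2)) (ZMod n × ZMod 2) := by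
    refine ⟨fun {g h} hgh => Prod.ext (dihedral_eq_of_smul_eq hn fun x => ?_) ?_⟩
    · exact congrArg Prod.fst (hgh (x, 0))
    · exact Multiplicative.toAdd.injective (add_right_cancel (congrArg Prod.snd (hgh (0, 0))))
  refine partitionNumber_axial_le (χ := prismRotation n) (ε := prismSide n) ?_ hside hrot ?_ ?_ ?_
    ?_ ?_
  · rintro ⟨a, s⟩ ⟨b, t⟩ h1 h2
    refine Prod.ext (ZMod.injective_toCircle h1) ?_
    have hinj : ∀ s t : ZMod 2, AddChar.zmodChar 2 (ζ := (-1 : ℤˣ)) (by decide) s =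
      AddChar.zmodChar 2 (ζ := (-1 : ℤˣ)) (by decide) t → s = t := by decide
    exact hinj s t h2
  · rintro ⟨i | i, t⟩
    · exact ⟨(i, t.toAdd), Or.inl fun x => rfl⟩
    -- Negation is trivial modulo 2, so the second coordinate may be read as a shift or as a
    -- reflection.
    · refine ⟨(-i, t.toAdd), Or.inr fun x => ?_⟩
      rw [prism_smul, sr_smul]
      exact Prod.ext rfl (by simp [sub_eq_add_neg, ZMod.neg_eq_self_mod_two])
  · rintro ⟨i, t⟩
    exact ⟨(.r i, .ofAdd t), fun x => rfl⟩
  · rintro ⟨i, t⟩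
    refine ⟨(.sr (-i), .ofAdd t), fun x => ?_⟩
    rw [prism_smul, sr_smul, neg_neg]
    exact Prod.ext rfl (by simp [sub_eq_add_neg, ZMod.neg_eq_self_mod_two])
  · intro u h0 h2
    obtain ⟨h, hh, hsim⟩ := exists_similar_axialMap hside hrot h0 h2
    refine ⟨h, hh, ?_⟩
    rwa [standardPrism, ← range_axialMap_prism]
  · simp
    omega

/-! ### Antiprisms. -/

variable (n) in
/-- The sign character of the two bases of an antiprism. -/
def antiprismSide [NeZero n] : AddChar (ZMod (2 * n)) ℤˣ :=
  AddChar.zmodChar (2 * n) (ζ := (-1 : ℤˣ)) (by rw [pow_mul, neg_one_sq, one_pow])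

theorem antiprismSide_natCast [NeZero n] (k : ℕ) :
    antiprismSide n (k : ZMod (2 * n)) = (-1) ^ k :=
  AddChar.zmodChar_apply' _ _

theorem range_axialMap_antiprism [NeZero n] (h : ℝ) :
    Set.range (axialMap ZMod.toCircle (antiprismSide n) !₂[1, 0, h]) =
      {v | ∃ k : ℕ, v =
        !₂[Real.cos (Real.pi * k / n), Real.sin (Real.pi * k / n), (-1) ^ k * h]} := by
  have hval : ∀ k : ℕ, axialMap ZMod.toCircle (antiprismSide n) !₂[1, 0, h] (k : ZMod (2 * n)) =
      !₂[Real.cos (Real.pi * k / n), Real.sin (Real.pi * k / n), (-1) ^ k * h] := by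
    intro k
    obtain ⟨h1, h2⟩ := toCircle_natCast_re_im (n := 2 * n) k
    have h3 : 2 * Real.pi * k / ((2 * n : ℕ) : ℝ) = Real.pi * k / n := by
      push_cast
      rw [mul_assoc, mul_div_mul_left _ _ two_ne_zero]
    rw [h3] at h1 h2
    simp [axialMap_apply, h1, h2, antiprismSide_natCast]
  ext v
  constructor
  · rintro ⟨a, rfl⟩
    obtain ⟨k, rfl⟩ := ZMod.natCast_zmod_surjective a
    exact ⟨k, hval k⟩
  · rintro ⟨k, rfl⟩
    exact ⟨k, hval k⟩

theorem partitionNumber_antiprisms_le (hn : 2 ≤ n) :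
    partitionNumber (withIso (rightRegularAntiprisms n) (DihedralGroup (2 * n))) ≤
      ((8 * n - 6 : ℕ) : ℕ∞) := by
  have : NeZero n := ⟨by omega⟩
  have hside : antiprismSide n 1 = -1 := by
    have := antiprismSide_natCast (n := n) 1
    rwa [Nat.cast_one, pow_one] at this
  have hrot := toCircle_one_im_ne_zero (n := 2 * n) (by omega)
  have : FaithfulSMul (DihedralGroup (2 * n)) (ZMod (2 * n)) :=
    ⟨fun {g h} hgh => dihedral_eq_of_smul_eq (by omega) hgh⟩
  refine partitionNumber_axial_le (χ := ZMod.toCircle) (ε := antiprismSide n) ?_ hside hrot ?_ ?_ ?_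
    ?_ ?_
  · exact fun a b h _ => ZMod.injective_toCircle h
  · rintro (i | i)
    · exact ⟨i, Or.inl fun x => rfl⟩
    · exact ⟨-i, Or.inr fun x => rfl⟩
  · exact fun i => ⟨.r i, fun x => rfl⟩
  · exact fun i => ⟨.sr (-i), fun x => by rw [sr_smul, neg_neg]⟩
  · intro u h0 h2
    obtain ⟨h, hh, hsim⟩ := exists_similar_axialMap hside hrot h0 h2
    refine ⟨h, hh, ?_⟩
    rwa [standardAntiprism, ← range_axialMap_antiprism]
  · simp
    omega

end Dihedral

/-! ### Groups of orthogonal maps of `ℝ³` and their rotations -/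

theorem orthogonalDet_eq_basis_det {d : ℕ} (e : Euc d ≃ₗᵢ[ℝ] Euc d) (v : Fin d → Euc d) :
    (EuclideanSpace.basisFun (Fin d) ℝ).toBasis.det (fun i => e (v i)) =
      orthogonalDet d e * (EuclideanSpace.basisFun (Fin d) ℝ).toBasis.det v :=
  Module.Basis.det_comp _ e.toLinearEquiv.toLinearMap v

theorem basisFun_det_fin_three (v : Fin 3 → Euc 3) :
    (EuclideanSpace.basisFun (Fin 3) ℝ).toBasis.det v =
      v 0 0 * v 1 1 * v 2 2 - v 0 0 * v 1 2 * v 2 1 - v 0 1 * v 1 0 * v 2 2 +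
        v 0 1 * v 1 2 * v 2 0 + v 0 2 * v 1 0 * v 2 1 - v 0 2 * v 1 1 * v 2 0 := by
  rw [Module.Basis.det_apply, Matrix.det_fin_three]
  simp [Module.Basis.toMatrix_apply]
  ring

theorem orthogonalDet_eq_fin_three (e : Euc 3 ≃ₗᵢ[ℝ] Euc 3) :
    orthogonalDet 3 e = (EuclideanSpace.basisFun (Fin 3) ℝ).toBasis.det
      fun i => e (EuclideanSpace.single i 1) := by
  rw [orthogonalDet_eq_basis_det e fun i => EuclideanSpace.single i 1, basisFun_det_fin_three]
  simp

theorem orthogonalDet_halfTurn (i : Fin 3) : orthogonalDet 3 (halfTurn i) = 1 := by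
  rw [orthogonalDet_eq_fin_three, basisFun_det_fin_three]
  fin_cases i <;> simp

theorem orthogonalDet_neg : orthogonalDet 3 (LinearIsometryEquiv.neg ℝ) = -1 := by
  rw [orthogonalDet_eq_fin_three, basisFun_det_fin_three]
  simp

theorem mem_rotations {d : ℕ} {G : Subgroup (Euc d ≃ₗᵢ[ℝ] Euc d)} {e : Euc d ≃ₗᵢ[ℝ] Euc d} :
    e ∈ rotations G ↔ e ∈ G ∧ orthogonalDet d e = 1 := Iff.rfl

theorem rotations_le {d : ℕ} (G : Subgroup (Euc d ≃ₗᵢ[ℝ] Euc d)) : rotations G ≤ G := inf_le_left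

theorem halfTurn_mem_rotations {G : Subgroup (Euc 3 ≃ₗᵢ[ℝ] Euc 3)} (hG : ∀ i, halfTurn i ∈ G)
    (i : Fin 3) : halfTurn i ∈ rotations G :=
  mem_rotations.2 ⟨hG i, orthogonalDet_halfTurn i⟩

theorem halfTurn_mem_orthogonalSymmetries {S : Set (Euc 3)} {i : Fin 3}
    (hS : ∀ x ∈ S, halfTurn i x ∈ S) : halfTurn i ∈ orthogonalSymmetries S := by
  refine Set.Subset.antisymm ?_ fun x hx => ⟨halfTurn i x, hS x hx, ?_⟩
  · rintro _ ⟨x, hx, rfl⟩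
    exact hS x hx
  · ext j
    simp only [halfTurn_apply]
    split_ifs
    · rfl
    · exact neg_neg _

theorem nonempty_mulEquiv_of_range_eq {K P : Type*} [Group K] [Group P] {φ : K →* P}
    (hφ : Function.Injective φ) {G : Subgroup P} (hG : φ.range = G) : Nonempty (K ≃* G) :=
  ⟨(MonoidHom.ofInjective hφ).trans (MulEquiv.subgroupCongr hG)⟩

/-- The group generated by the point reflection. -/
noncomputable def pointReflections (d : ℕ) : ℤˣ →* (Euc d ≃ₗᵢ[ℝ] Euc d) where
  toFun s := if s = 1 then 1 else LinearIsometryEquiv.neg ℝ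
  map_one' := if_pos rfl
  map_mul' s t := by
    ext x : 1
    rcases Int.units_eq_one_or s with rfl | rfl <;> rcases Int.units_eq_one_or t with rfl | rfl <;>
      simp [show (-1 : ℤˣ) ≠ 1 by decide]

theorem pointReflections_apply {d : ℕ} (s : ℤˣ) (x : Euc d) :
    pointReflections d s x = ((s : ℤ) : ℝ) • x := by
  rcases Int.units_eq_one_or s with rfl | rfl <;>
    simp [pointReflections, show (-1 : ℤˣ) ≠ 1 by decide]

theorem commute_pointReflections {d : ℕ} (e : Euc d ≃ₗᵢ[ℝ] Euc d) (s : ℤˣ) :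
    Commute e (pointReflections d s) := by
  ext x : 1
  change e (pointReflections d s x) = pointReflections d s (e x)
  rw [pointReflections_apply, pointReflections_apply, map_smul]

theorem orthogonalDet_pointReflections (s : ℤˣ) :
    orthogonalDet 3 (pointReflections 3 s) = ((s : ℤ) : ℝ) := by
  rcases Int.units_eq_one_or s with rfl | rfl
  · simp
  · simpa [pointReflections, show (-1 : ℤˣ) ≠ 1 by decide] using orthogonalDet_neg

/-- A group of order two as the group of signs. -/
def signOfZMod : Multiplicative (ZMod 2) →* ℤˣ :=
  (AddChar.zmodChar 2 (ζ := (-1 : ℤˣ)) (by decide)).toMonoidHom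

theorem signOfZMod_bijective : Function.Bijective signOfZMod := by
  constructor
  · have : ∀ a b : ZMod 2, signOfZMod (.ofAdd a) = signOfZMod (.ofAdd b) → a = b := by decide
    exact fun a b h => Multiplicative.toAdd.injective (this _ _ h)
  · intro s
    rcases Int.units_eq_one_or s with rfl | rfl
    · exact ⟨1, rfl⟩
    · exact ⟨.ofAdd 1, rfl⟩

/-- The extension of a group of orthogonal maps by the point reflection. -/
noncomputable def withPointReflection {K : Type*} [Group K] {d : ℕ}
    (φ : K →* (Euc d ≃ₗᵢ[ℝ] Euc d)) :
    K × Multiplicative (ZMod 2) →* (Euc d ≃ₗᵢ[ℝ] Euc d) :=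
  φ.noncommCoprod ((pointReflections d).comp signOfZMod) fun _ _ => commute_pointReflections _ _

theorem withPointReflection_apply {K : Type*} [Group K] {d : ℕ}
    (φ : K →* (Euc d ≃ₗᵢ[ℝ] Euc d)) (k : K × Multiplicative (ZMod 2)) :
    withPointReflection φ k = φ k.1 * pointReflections d (signOfZMod k.2) := rfl

theorem injective_withPointReflection {K : Type*} [Group K] {φ : K →* (Euc 3 ≃ₗᵢ[ℝ] Euc 3)}
    (hφ : Function.Injective φ) (hneg : ∀ k, φ k ≠ pointReflections 3 (-1)) :
    Function.Injective (withPointReflection φ) := by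
  rw [injective_iff_map_eq_one]
  rintro ⟨k, z⟩ h
  rw [withPointReflection_apply] at h
  obtain ⟨s, hs⟩ : ∃ s, signOfZMod z = s := ⟨_, rfl⟩
  dsimp only at h
  rw [hs] at h
  rcases Int.units_eq_one_or s with rfl | rfl
  · rw [map_one, mul_one] at h
    exact Prod.ext ((injective_iff_map_eq_one φ).1 hφ k h)
      ((injective_iff_map_eq_one signOfZMod).1 signOfZMod_bijective.1 z hs)
  · refine absurd ?_ (hneg k)
    rw [eq_inv_of_mul_eq_one_left h, ← map_inv]
    rfl

/-! ### The tetrahedral and octahedral groups -/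

/-- The vertices of a tetrahedron. -/
noncomputable def tetrahedronVertex : Fin 4 → Euc 3 :=
  ![!₂[1, 1, 1], !₂[1, -1, -1], !₂[-1, 1, -1], !₂[-1, -1, 1]]

theorem range_tetrahedronVertex : Set.range tetrahedronVertex = tetrahedronVertices := by
  ext v
  constructor
  · rintro ⟨i, rfl⟩
    fin_cases i <;> simp [tetrahedronVertex, tetrahedronVertices]
  · rintro (rfl | rfl | rfl | rfl)
    exacts [⟨0, rfl⟩, ⟨1, rfl⟩, ⟨2, rfl⟩, ⟨3, rfl⟩]

theorem inner_tetrahedronVertex (i j : Fin 4) :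
    inner ℝ (tetrahedronVertex i) (tetrahedronVertex j) = if i = j then 3 else -1 := by
  rw [PiLp.inner_apply, Fin.sum_univ_three]
  fin_cases i <;> fin_cases j <;> simp [tetrahedronVertex] <;> norm_num

theorem injective_tetrahedronVertex : Function.Injective tetrahedronVertex := fun i j h => by
  have h1 := inner_tetrahedronVertex i j
  rw [h, inner_tetrahedronVertex, if_pos rfl] at h1
  by_contra hij
  rw [if_neg hij] at h1
  norm_num at h1

theorem span_tetrahedronVertex : Submodule.span ℝ (Set.range tetrahedronVertex) = ⊤ := by
  rw [← Submodule.orthogonal_eq_bot_iff, Submodule.eq_bot_iff]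
  intro w hw
  have hw' : ∀ a, inner ℝ (tetrahedronVertex a) w = 0 := fun a =>
    (Submodule.mem_orthogonal _ _).1 hw _ (Submodule.subset_span ⟨a, rfl⟩)
  have e0 := hw' 0
  have e1 := hw' 1
  have e2 := hw' 2
  have e3 := hw' 3
  simp [PiLp.inner_apply, Fin.sum_univ_three, tetrahedronVertex] at e0 e1 e2 e3
  ext i
  fin_cases i <;> simp <;> linarith

/-- The Gram matrix has only two values, one on and one off the diagonal, so every permutation of
the four vertices is realized by an orthogonal map. -/
theorem exists_tetrahedralHom : ∃ φ : Equiv.Perm (Fin 4) →* (Euc 3 ≃ₗᵢ[ℝ] Euc 3),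
    Function.Injective φ ∧ φ.range = tetrahedralGroup ∧
      (∀ p i, φ p (tetrahedronVertex i) = tetrahedronVertex (p i)) ∧
      ∀ p, orthogonalDet 3 (φ p) = ((Equiv.Perm.sign p : ℤ) : ℝ) := by
  obtain ⟨Ψ, hΨ⟩ := exists_mulEquiv_orthogonalSymmetries (K := Equiv.Perm (Fin 4))
    injective_tetrahedronVertex (fun k x y => by
      rw [inner_tetrahedronVertex, inner_tetrahedronVertex]
      simp) span_tetrahedronVertex fun σ _ => ⟨σ, fun x => rfl⟩
  let φ : Equiv.Perm (Fin 4) →* (Euc 3 ≃ₗᵢ[ℝ] Euc 3) := (Subgroup.subtype _).comp Ψ.toMonoidHom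
  refine ⟨φ, Subtype.val_injective.comp Ψ.injective, ?_, hΨ, fun p => ?_⟩
  · rw [tetrahedralGroup, ← range_tetrahedronVertex]
    ext e
    exact ⟨fun ⟨p, hp⟩ => hp ▸ (Ψ p).2, fun he => ⟨Ψ.symm ⟨e, he⟩, by simp [φ]⟩⟩
  -- Swapping vertices 0 and 1 exchanges two members of the basis formed by the first three
  -- vertices. All other transpositions are conjugate to this one.
  · have h12 : orthogonalDet 3 (φ (Equiv.swap 0 1)) = -1 := by
      let b := (EuclideanSpace.basisFun (Fin 3) ℝ).toBasis
      let w : Fin 3 → Euc 3 := fun i => tetrahedronVertex i.castSucc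
      have hw : b.det w ≠ 0 := by
        rw [basisFun_det_fin_three]
        simp [w, tetrahedronVertex]
        norm_num
      have h1 := orthogonalDet_eq_basis_det (φ (Equiv.swap 0 1)) w
      have h2 : (fun i => φ (Equiv.swap 0 1) (w i)) = w ∘ Equiv.swap 0 1 := by
        funext i
        refine (hΨ _ _).trans (congrArg tetrahedronVertex ?_)
        revert i
        decide
      rw [h2, AlternatingMap.map_swap _ _ (by decide)] at h1
      have h3 : (orthogonalDet 3 (φ (Equiv.swap 0 1)) + 1) * b.det w = 0 := by
        rw [add_mul, ← h1, one_mul, neg_add_cancel]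
      linarith [(mul_eq_zero.1 h3).resolve_right hw]
    have hswap : ∀ i j, i ≠ j → orthogonalDet 3 (φ (Equiv.swap i j)) = -1 := fun i j hij => by
      rw [← h12]
      exact isConj_iff_eq.1 (((orthogonalDet 3).comp φ).map_isConj
        (Equiv.Perm.isConj_swap hij (by decide)))
    induction p using Equiv.Perm.swap_induction_on with
    | one => simp
    | swap_mul p i j hij ih =>
      rw [map_mul, map_mul, hswap i j hij, ih, map_mul, Equiv.Perm.sign_swap hij]
      push_cast
      ring

theorem halfTurn_mem_tetrahedralGroup (i : Fin 3) : halfTurn i ∈ tetrahedralGroup := by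
  refine halfTurn_mem_orthogonalSymmetries fun x hx => ?_
  have key : ∀ j, ∃ k, halfTurn i (tetrahedronVertex j) = tetrahedronVertex k := by
    intro j
    refine ⟨![![1, 0, 3, 2], ![2, 3, 0, 1], ![3, 2, 1, 0]] i j, ?_⟩
    ext l
    fin_cases i <;> fin_cases j <;> fin_cases l <;> simp [tetrahedronVertex]
  rw [← range_tetrahedronVertex] at hx ⊢
  obtain ⟨j, rfl⟩ := hx
  obtain ⟨k, hk⟩ := key j
  exact ⟨k, hk.symm⟩

theorem halfTurn_mem_octahedralGroup (i : Fin 3) : halfTurn i ∈ octahedralGroup := by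
  refine halfTurn_mem_orthogonalSymmetries fun x hx j => ?_
  rw [halfTurn_apply]
  rcases hx j with h | h <;> rw [h] <;> split_ifs <;> simp

theorem mem_cubeVertices_iff {x : Euc 3} :
    x ∈ cubeVertices ↔ ∃ (s : ℤˣ) (i : Fin 4), x = ((s : ℤ) : ℝ) • tetrahedronVertex i := by
  constructor
  · intro hx
    have hx' : x = !₂[x 0, x 1, x 2] := by
      ext i; fin_cases i <;> rfl
    rw [hx']
    rcases hx 0 with h0 | h0 <;> rcases hx 1 with h1 | h1 <;> rcases hx 2 with h2 | h2 <;>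
      rw [h0, h1, h2]
    · exact ⟨1, 0, by simp [tetrahedronVertex]⟩
    · exact ⟨-1, 3, by ext i; fin_cases i <;> simp [tetrahedronVertex]⟩
    · exact ⟨-1, 2, by ext i; fin_cases i <;> simp [tetrahedronVertex]⟩
    · exact ⟨1, 1, by simp [tetrahedronVertex]⟩
    · exact ⟨-1, 1, by ext i; fin_cases i <;> simp [tetrahedronVertex]⟩
    · exact ⟨1, 2, by simp [tetrahedronVertex]⟩
    · exact ⟨1, 3, by simp [tetrahedronVertex]⟩
    · exact ⟨-1, 0, by ext i; fin_cases i <;> simp [tetrahedronVertex]⟩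
  · rintro ⟨s, i, rfl⟩ j
    rcases Int.units_eq_one_or s with rfl | rfl <;> fin_cases i <;> fin_cases j <;>
      simp [tetrahedronVertex]

/-- Up to sign, a symmetry of the cube is a symmetry of the inscribed tetrahedron. -/
theorem exists_tetrahedral_mul_pointReflection {φ : Equiv.Perm (Fin 4) →* (Euc 3 ≃ₗᵢ[ℝ] Euc 3)}
    (hφ : ∀ p i, φ p (tetrahedronVertex i) = tetrahedronVertex (p i)) (e : Euc 3 ≃ₗᵢ[ℝ] Euc 3) :
    e ∈ octahedralGroup ↔ ∃ p s, e = φ p * pointReflections 3 s := by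
  constructor
  · intro he
    have h1 : ∀ i, ∃ (s : ℤˣ) (j : Fin 4),
        e (tetrahedronVertex i) = ((s : ℤ) : ℝ) • tetrahedronVertex j := fun i => by
      rw [← mem_cubeVertices_iff]
      have h2 : e '' cubeVertices = cubeVertices := he
      rw [← h2]
      exact ⟨_, mem_cubeVertices_iff.2 ⟨1, i, by simp⟩, rfl⟩
    choose s σ hσ using h1
    have hgram : ∀ i j, ((s i : ℤ) : ℝ) * (((s j : ℤ) : ℝ) * (if σ i = σ j then 3 else -1)) =
        if i = j then 3 else -1 := fun i j => by
      rw [← inner_tetrahedronVertex i j, ← e.inner_map_map, hσ, hσ, real_inner_smul_left,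
        real_inner_smul_right, inner_tetrahedronVertex]
    -- Distinct tetrahedron vertices have inner product -1. Of the possible values ±3 and ±1 this
    -- singles out equal signs and distinct vertices.
    have hs : ∀ i j, i ≠ j → s i = s j ∧ σ i ≠ σ j := by
      intro i j hij
      have h2 := hgram i j
      rw [if_neg hij] at h2
      rcases Int.units_eq_one_or (s i) with hi | hi <;>
        rcases Int.units_eq_one_or (s j) with hj | hj <;> rw [hi, hj] at h2 ⊢ <;>
        split_ifs at h2 with h3 <;> norm_num at h2 <;> exact ⟨rfl, h3⟩
    have hinj : Function.Injective σ := fun i j h => by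
      by_contra hij
      exact (hs i j hij).2 h
    refine ⟨Equiv.ofBijective σ (Finite.injective_iff_bijective.1 hinj), s 0,
      linearIsometryEquiv_ext_of_span span_tetrahedronVertex fun i => ?_⟩
    have hs0 : s i = s 0 := by
      by_cases hi : i = 0
      · rw [hi]
      · exact (hs i 0 hi).1
    rw [hσ, hs0, (commute_pointReflections _ _).eq]
    change _ = pointReflections 3 (s 0) (φ _ (tetrahedronVertex i))
    rw [pointReflections_apply, hφ]
    rfl
  · rintro ⟨p, s, rfl⟩
    have hsub : ∀ p s, ∀ x ∈ cubeVertices, (φ p * pointReflections 3 s) x ∈ cubeVertices := by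
      intro p s x hx
      obtain ⟨t, i, rfl⟩ := mem_cubeVertices_iff.1 hx
      refine mem_cubeVertices_iff.2 ⟨s * t, p i, ?_⟩
      change φ p (pointReflections 3 s _) = _
      rw [pointReflections_apply, map_smul, map_smul, hφ, smul_smul]
      push_cast
      rfl
    refine Set.Subset.antisymm ?_ fun x hx => ?_
    · rintro _ ⟨x, hx, rfl⟩
      exact hsub p s x hx
    · refine ⟨_, hsub p⁻¹ s⁻¹ x hx, ?_⟩
      have h : φ p * pointReflections 3 s * (φ p⁻¹ * pointReflections 3 s⁻¹) = 1 := by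
        rw [map_inv, map_inv, (commute_pointReflections (φ p) s).eq]
        group
      change (φ p * pointReflections 3 s * (φ p⁻¹ * pointReflections 3 s⁻¹)) x = x
      rw [h]
      rfl

/-! ### Inversion rigidity of S₄, A₄ and A₅ by finite verification. -/

theorem inversionRigid_perm_four : InversionRigid (Equiv.Perm (Fin 4)) := by
  unfold InversionRigid
  decide +kernel

theorem inversionRigid_alternatingGroup_four : InversionRigid (alternatingGroup (Fin 4)) := by
  unfold InversionRigid
  decide +kernel

theorem inversionRigid_alternatingGroup_five : InversionRigid (alternatingGroup (Fin 5)) := by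
  unfold InversionRigid
  decide +kernel

theorem zmod_two_mul_self (a : Multiplicative (ZMod 2)) : a * a = 1 := by
  revert a
  decide

theorem finite_of_range_eq {K P : Type*} [Group K] [Finite K] [Group P] {φ : K →* P}
    {G : Subgroup P} (hG : φ.range = G) : Finite G := by
  subst hG
  exact Set.finite_range φ

/-! ### The icosahedral group -/

/-- The coordinates of the vertices of a regular icosahedron in `ℤ[φ]`, where `(a, b)` stands for
`a + b φ`. -/
def icosahedronCoord : Fin 12 → Fin 3 → ℤ × ℤ :=
  ![![(0, 0), (1, 0), (0, 1)], ![(0, 0), (1, 0), (0, -1)],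
    ![(0, 0), (-1, 0), (0, 1)], ![(0, 0), (-1, 0), (0, -1)],
    ![(0, 1), (0, 0), (1, 0)], ![(0, -1), (0, 0), (1, 0)],
    ![(0, 1), (0, 0), (-1, 0)], ![(0, -1), (0, 0), (-1, 0)],
    ![(1, 0), (0, 1), (0, 0)], ![(1, 0), (0, -1), (0, 0)],
    ![(-1, 0), (0, 1), (0, 0)], ![(-1, 0), (0, -1), (0, 0)]]

/-- A conjugacy class of five-cycles in the alternating group, in bijection with the vertices of
the icosahedron. -/
def icosahedronCycle : Fin 12 → Equiv.Perm (Fin 5) :=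
  ![List.formPerm [0, 1, 2, 3, 4], List.formPerm [0, 1, 3, 4, 2], List.formPerm [0, 2, 4, 3, 1],
    List.formPerm [0, 4, 3, 2, 1], List.formPerm [0, 4, 1, 3, 2], List.formPerm [0, 4, 2, 1, 3],
    List.formPerm [0, 3, 1, 2, 4], List.formPerm [0, 2, 3, 1, 4], List.formPerm [0, 2, 1, 4, 3],
    List.formPerm [0, 1, 4, 2, 3], List.formPerm [0, 3, 2, 4, 1], List.formPerm [0, 3, 4, 1, 2]]

/-- The product in `ℤ[φ]`. -/
def goldenMul (x y : ℤ × ℤ) : ℤ × ℤ := (x.1 * y.1 + x.2 * y.2, x.1 * y.2 + x.2 * y.1 + x.2 * y.2)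

/-- The Gram matrix of the icosahedron. -/
def icosahedronGram (i j : Fin 12) : ℤ × ℤ :=
  goldenMul (icosahedronCoord i 0) (icosahedronCoord j 0) +
    goldenMul (icosahedronCoord i 1) (icosahedronCoord j 1) +
    goldenMul (icosahedronCoord i 2) (icosahedronCoord j 2)

/-- The Gram matrix of the icosahedron in terms of five-cycles. -/
def cycleGram (c d : Equiv.Perm (Fin 5)) : ℤ × ℤ :=
  if c = d then (2, 1) else if c * d = 1 then (-2, -1) else if (c * d) ^ 3 = 1 then (0, 1)
  else (0, -1)

/-- The real number `a + b φ`. -/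
noncomputable def goldenEval (x : ℤ × ℤ) : ℝ := x.1 + x.2 * Real.goldenRatio

theorem goldenEval_add (x y : ℤ × ℤ) : goldenEval (x + y) = goldenEval x + goldenEval y := by
  simp [goldenEval]
  ring

theorem goldenEval_mul (x y : ℤ × ℤ) :
    goldenEval (goldenMul x y) = goldenEval x * goldenEval y := by
  simp only [goldenEval, goldenMul]
  push_cast
  linear_combination (-(x.2 : ℝ) * y.2) * Real.goldenRatio_sq

/-- By irrationality of φ, equalities between real Gram entries reduce to decidable equalities of
integer pairs. -/
theorem injective_goldenEval : Function.Injective goldenEval := by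
  intro x y h
  simp only [goldenEval] at h
  have h1 : ((x.2 - y.2 : ℤ) : ℝ) * Real.goldenRatio = ((y.1 - x.1 : ℤ) : ℝ) := by
    push_cast
    linarith
  have h2 : x.2 = y.2 := by
    by_contra hne
    have hne' : ((x.2 - y.2 : ℤ) : ℝ) ≠ 0 := Int.cast_ne_zero.2 (sub_ne_zero.2 hne)
    refine Real.goldenRatio_irrational ⟨((y.1 - x.1 : ℤ) : ℚ) / ((x.2 - y.2 : ℤ) : ℚ), ?_⟩
    rw [Rat.cast_div, Rat.cast_intCast, Rat.cast_intCast, div_eq_iff hne', mul_comm, h1]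
  refine Prod.ext ?_ h2
  rw [h2, add_left_inj] at h
  exact_mod_cast h

/-- The right-hand side is invariant under simultaneous conjugation. Conjugating five-cycles thus
provides the action of A₅ on the icosahedron without writing down any matrices. -/
theorem icosahedronGram_eq_cycleGram :
    ∀ i j, icosahedronGram i j = cycleGram (icosahedronCycle i) (icosahedronCycle j) := by
  decide +kernel

theorem injective_icosahedronCycle : Function.Injective icosahedronCycle := by
  have : ∀ i j, icosahedronCycle i = icosahedronCycle j → i = j := by decide +kernel
  exact fun i j => this i j

/-- Odd permutations exchange the class of five-cycles with the class of its squares. -/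
theorem exists_conj_icosahedronCycle_perm (g : Equiv.Perm (Fin 5)) (i : Fin 12) :
    ∃ j, g * icosahedronCycle i * g⁻¹ = icosahedronCycle j ^ (if g.sign = 1 then 1 else 2) := by
  have hswap : ∀ (a b : Fin 5), a ≠ b → ∀ i : Fin 12, ∃ j,
      Equiv.swap a b * icosahedronCycle i * (Equiv.swap a b)⁻¹ = icosahedronCycle j ^ 2 := by
    decide +kernel
  -- The fourth power of a five-cycle is its inverse, which belongs to the antipodal vertex.
  have hpow : ∀ i : Fin 12, ∃ j, (icosahedronCycle i ^ 2) ^ 2 = icosahedronCycle j := by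
    decide +kernel
  induction g using Equiv.Perm.swap_induction_on generalizing i with
  | one => exact ⟨i, by simp⟩
  | swap_mul g a b hab ih =>
    obtain ⟨j, hj⟩ := ih i
    obtain ⟨k, hk⟩ := hswap a b hab j
    have hconj : Equiv.swap a b * g * icosahedronCycle i * (Equiv.swap a b * g)⁻¹ =
        (icosahedronCycle k ^ 2) ^ (if g.sign = 1 then 1 else 2) := by
      rw [← hk, conj_pow, ← hj]
      group
    rw [hconj, Equiv.Perm.sign_mul, Equiv.Perm.sign_swap hab]
    rcases Int.units_eq_one_or g.sign with h | h <;> rw [h]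
    · exact ⟨k, by simp⟩
    · obtain ⟨l, hl⟩ := hpow k
      exact ⟨l, by simpa using hl⟩

theorem exists_conj_icosahedronCycle (g : alternatingGroup (Fin 5)) (i : Fin 12) :
    ∃ j, icosahedronCycle j = g.1 * icosahedronCycle i * g.1⁻¹ := by
  obtain ⟨j, hj⟩ := exists_conj_icosahedronCycle_perm g.1 i
  rw [if_pos (Equiv.Perm.mem_alternatingGroup.1 g.2), pow_one] at hj
  exact ⟨j, hj.symm⟩

theorem eq_one_of_commute_icosahedronCycle : ∀ g : Equiv.Perm (Fin 5),
    (∀ i, icosahedronCycle i = g * icosahedronCycle i * g⁻¹) → g = 1 := by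
  decide +kernel

theorem cycleGram_conj (g c d : Equiv.Perm (Fin 5)) :
    cycleGram (g * c * g⁻¹) (g * d * g⁻¹) = cycleGram c d := by
  have h1 : g * c * g⁻¹ * (g * d * g⁻¹) = g * (c * d) * g⁻¹ := by group
  simp only [cycleGram, h1, conj_pow, conj_eq_one_iff, mul_left_inj, mul_right_inj]

/-- The vertices of a regular icosahedron. -/
noncomputable def icosahedronVertex (i : Fin 12) : Euc 3 :=
  !₂[goldenEval (icosahedronCoord i 0), goldenEval (icosahedronCoord i 1),
    goldenEval (icosahedronCoord i 2)]

theorem inner_icosahedronVertex (i j : Fin 12) :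
    inner ℝ (icosahedronVertex i) (icosahedronVertex j) = goldenEval (icosahedronGram i j) := by
  rw [PiLp.inner_apply, Fin.sum_univ_three, icosahedronGram]
  simp only [goldenEval_add, goldenEval_mul]
  simp [icosahedronVertex]
  ring

theorem injective_icosahedronVertex : Function.Injective icosahedronVertex := by
  intro i j h
  have h1 := inner_icosahedronVertex i j
  rw [h, inner_icosahedronVertex] at h1
  have : ∀ i j, icosahedronGram j j = icosahedronGram i j → i = j := by decide +kernel
  exact this i j (injective_goldenEval h1)

theorem range_icosahedronVertex : Set.range icosahedronVertex = icosahedronVertices := by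
  ext v
  constructor
  · rintro ⟨i, rfl⟩
    have h : ∀ i, ∃ s t : ℤˣ,
        (icosahedronCoord i 0 = (0, 0) ∧ icosahedronCoord i 1 = ((s : ℤ), 0) ∧
          icosahedronCoord i 2 = (0, (t : ℤ))) ∨
        (icosahedronCoord i 0 = (0, (t : ℤ)) ∧ icosahedronCoord i 1 = (0, 0) ∧
          icosahedronCoord i 2 = ((s : ℤ), 0)) ∨
        (icosahedronCoord i 0 = ((s : ℤ), 0) ∧ icosahedronCoord i 1 = (0, (t : ℤ)) ∧
          icosahedronCoord i 2 = (0, 0)) := by decide +kernel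
    have hcast : ∀ s : ℤˣ, ((s : ℤ) : ℝ) = 1 ∨ ((s : ℤ) : ℝ) = -1 := fun s => by
      rcases Int.units_eq_one_or s with rfl | rfl <;> simp
    obtain ⟨s, t, h⟩ := h i
    refine ⟨((s : ℤ) : ℝ), ((t : ℤ) : ℝ), hcast s, hcast t, ?_⟩
    rcases h with ⟨h0, h1, h2⟩ | ⟨h0, h1, h2⟩ | ⟨h0, h1, h2⟩ <;>
      simp [icosahedronVertex, h0, h1, h2, goldenEval]
  · rintro ⟨s, t, rfl | rfl, rfl | rfl, rfl | rfl | rfl⟩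
    exacts [⟨0, by simp [icosahedronVertex, icosahedronCoord, goldenEval]⟩,
      ⟨4, by simp [icosahedronVertex, icosahedronCoord, goldenEval]⟩,
      ⟨8, by simp [icosahedronVertex, icosahedronCoord, goldenEval]⟩,
      ⟨1, by simp [icosahedronVertex, icosahedronCoord, goldenEval]⟩,
      ⟨5, by simp [icosahedronVertex, icosahedronCoord, goldenEval]⟩,
      ⟨9, by simp [icosahedronVertex, icosahedronCoord, goldenEval]⟩,
      ⟨2, by simp [icosahedronVertex, icosahedronCoord, goldenEval]⟩,
      ⟨6, by simp [icosahedronVertex, icosahedronCoord, goldenEval]⟩,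
      ⟨10, by simp [icosahedronVertex, icosahedronCoord, goldenEval]⟩,
      ⟨3, by simp [icosahedronVertex, icosahedronCoord, goldenEval]⟩,
      ⟨7, by simp [icosahedronVertex, icosahedronCoord, goldenEval]⟩,
      ⟨11, by simp [icosahedronVertex, icosahedronCoord, goldenEval]⟩]

/-- The vertices of a face of the icosahedron. -/
def icosahedronFace : Fin 3 → Fin 12 := ![0, 2, 4]

theorem span_icosahedronFace :
    Submodule.span ℝ (Set.range fun i => icosahedronVertex (icosahedronFace i)) = ⊤ := by
  rw [← Submodule.orthogonal_eq_bot_iff, Submodule.eq_bot_iff]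
  intro w hw
  have hw' : ∀ a, inner ℝ (icosahedronVertex (icosahedronFace a)) w = 0 := fun a =>
    (Submodule.mem_orthogonal _ _).1 hw _ (Submodule.subset_span ⟨a, rfl⟩)
  have e0 := hw' 0
  have e1 := hw' 1
  have e2 := hw' 2
  simp [PiLp.inner_apply, Fin.sum_univ_three, icosahedronVertex, icosahedronFace,
    icosahedronCoord, goldenEval] at e0 e1 e2
  have hφ := Real.goldenRatio_ne_zero
  have w2 : w 2 = 0 := by
    have : Real.goldenRatio * w 2 = 0 := by linarith
    exact (mul_eq_zero.1 this).resolve_left hφ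
  have w1 : w 1 = 0 := by
    rw [w2] at e0
    linarith
  have w0 : w 0 = 0 := by
    have : Real.goldenRatio * w 0 = 0 := by
      rw [w2] at e2
      linarith
    exact (mul_eq_zero.1 this).resolve_left hφ
  ext i
  fin_cases i
  exacts [w0, w1, w2]

theorem span_icosahedronVertex : Submodule.span ℝ (Set.range icosahedronVertex) = ⊤ :=
  top_unique (span_icosahedronFace ▸ Submodule.span_mono
    (Set.range_comp_subset_range icosahedronFace icosahedronVertex))

/-- The triples of mutually adjacent vertices of the icosahedron. -/
def icosahedronFlags : Finset (Fin 12 × Fin 12 × Fin 12) :=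
  {p | icosahedronGram p.1 p.2.1 = (0, 1) ∧ icosahedronGram p.1 p.2.2 = (0, 1) ∧
    icosahedronGram p.2.1 p.2.2 = (0, 1)}

theorem card_icosahedronFlags : icosahedronFlags.card = 120 := by
  decide +kernel

/-- A symmetry is determined by the image of one face, whose vertices span, and this image is one of
the 120 ordered triples of mutually adjacent vertices. -/
theorem finite_and_card_icosahedralGroup_le :
    Finite icosahedralGroup ∧ Nat.card icosahedralGroup ≤ 120 := by
  have h1 : ∀ (e : icosahedralGroup) (i : Fin 12), ∃ j, icosahedronVertex j =
      e.1 (icosahedronVertex i) := fun e i => by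
    have h2 : e.1 '' icosahedronVertices = icosahedronVertices := e.2
    rw [← range_icosahedronVertex] at h2
    have h3 : e.1 (icosahedronVertex i) ∈ Set.range icosahedronVertex := h2 ▸ ⟨_, ⟨i, rfl⟩, rfl⟩
    exact h3
  choose σ hσ using h1
  have hgram : ∀ e i j, icosahedronGram (σ e i) (σ e j) = icosahedronGram i j := fun e i j =>
    injective_goldenEval (by
      rw [← inner_icosahedronVertex, hσ, hσ, e.1.inner_map_map, inner_icosahedronVertex])
  let F : icosahedralGroup → icosahedronFlags := fun e => ⟨(σ e 0, σ e 2, σ e 4), by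
    simp only [icosahedronFlags, Finset.mem_filter, Finset.mem_univ, true_and, hgram]
    decide⟩
  have hF : Function.Injective F := fun e e' h => by
    have h2 := congrArg Subtype.val h
    refine Subtype.ext (linearIsometryEquiv_ext_of_span span_icosahedronFace fun i => ?_)
    rw [← hσ, ← hσ]
    congr 1
    fin_cases i
    exacts [congrArg Prod.fst h2, congrArg (fun p => p.2.1) h2, congrArg (fun p => p.2.2) h2]
  refine ⟨Finite.of_injective F hF, (Nat.card_le_card_of_injective F hF).trans ?_⟩
  rw [Nat.card_eq_fintype_card, Fintype.card_coe, card_icosahedronFlags]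

/-- A₅ is perfect, so every homomorphism to the abelian group `ℝˣ` is trivial. -/
theorem orthogonalDet_eq_one_of_alternatingGroup_five {d : ℕ}
    (φ : alternatingGroup (Fin 5) →* (Euc d ≃ₗᵢ[ℝ] Euc d)) (g : alternatingGroup (Fin 5)) :
    orthogonalDet d (φ g) = 1 := by
  let ψ : alternatingGroup (Fin 5) →* ℝˣ := ((orthogonalDet d).comp φ).toHomUnits
  have h1 : g ∈ commutator (alternatingGroup (Fin 5)) := by
    rw [commutator_alternatingGroup_eq_top (by simp)]
    trivial
  have h2 : ψ g = 1 := Abelianization.commutator_subset_ker ψ h1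
  exact congrArg Units.val h2

theorem exists_icosahedralHom : ∃ φ : alternatingGroup (Fin 5) →* (Euc 3 ≃ₗᵢ[ℝ] Euc 3),
    Function.Injective φ ∧ ∀ g, φ g ∈ icosahedralGroup := by
  choose act hact using exists_conj_icosahedronCycle
  let _ : MulAction (alternatingGroup (Fin 5)) (Fin 12) :=
    { smul := act
      one_smul := fun i => injective_icosahedronCycle ((hact 1 i).trans (by simp))
      mul_smul := fun g h i => injective_icosahedronCycle (by
        change icosahedronCycle (act (g * h) i) = icosahedronCycle (act g (act h i))
        rw [hact, hact, hact]
        simp [mul_assoc]) }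
  have hsmul : ∀ (g : alternatingGroup (Fin 5)) i,
      icosahedronCycle (g • i) = g.1 * icosahedronCycle i * g.1⁻¹ := hact
  obtain ⟨φ, hφ⟩ := exists_monoidHom_of_gram_smul (K := alternatingGroup (Fin 5)) (fun k x y => by
    rw [inner_icosahedronVertex, inner_icosahedronVertex, icosahedronGram_eq_cycleGram,
      icosahedronGram_eq_cycleGram, hsmul, hsmul, cycleGram_conj]) span_icosahedronVertex
  refine ⟨φ, (injective_iff_map_eq_one φ).2 fun g hg => ?_, fun g => ?_⟩
  · refine Subtype.ext (eq_one_of_commute_icosahedronCycle g.1 fun i => ?_)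
    rw [← hsmul]
    congr 1
    apply injective_icosahedronVertex
    rw [← hφ, hg]
    rfl
  · rw [icosahedralGroup, ← range_icosahedronVertex, mem_orthogonalSymmetries, ← Set.range_comp]
    have : φ g ∘ icosahedronVertex = icosahedronVertex ∘ fun x => g • x := funext fun x => hφ g x
    rw [this, (MulAction.surjective g).range_comp]

theorem halfTurn_mem_icosahedralGroup (i : Fin 3) : halfTurn i ∈ icosahedralGroup := by
  refine halfTurn_mem_orthogonalSymmetries fun x hx => ?_
  rw [← range_icosahedronVertex] at hx ⊢
  obtain ⟨j, rfl⟩ := hx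
  have key : ∀ (i : Fin 3) (j : Fin 12), ∃ k, ∀ l, icosahedronCoord k l =
      if l = i then icosahedronCoord j l else -icosahedronCoord j l := by decide +kernel
  obtain ⟨k, hk⟩ := key i j
  have hneg : ∀ x, goldenEval (-x) = -goldenEval x := fun x => by
    simp [goldenEval]
    ring
  refine ⟨k, ?_⟩
  ext l
  have h1 : ∀ m l, icosahedronVertex m l = goldenEval (icosahedronCoord m l) := fun m l => by
    fin_cases l <;> rfl
  rw [halfTurn_apply, h1, h1, hk, ← hneg]
  split_ifs <;> rfl

theorem eq_one_of_intCast_eq_one {s : ℤˣ} (h : ((s : ℤ) : ℝ) = 1) : s = 1 :=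
  Units.ext (Int.cast_injective (h.trans Int.cast_one.symm))

/-! ### The partition numbers -/

theorem similar_refl {d : ℕ} (P : Set (Euc d)) : Similar P P := by
  simpa using similar_image_add_left P 0

theorem orbitPolytope_mem_permutahedra {d : ℕ} {G : Subgroup (Euc d ≃ₗᵢ[ℝ] Euc d)} (u : Euc d)
    (hu : TrivialStabilizer G u) : orbitPolytope G u ∈ permutahedra G :=
  ⟨u, hu, similar_refl _⟩

theorem orbitPolytope_mem_alternahedra {d : ℕ} {G : Subgroup (Euc d ≃ₗᵢ[ℝ] Euc d)} (u : Euc d)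
    (hu : TrivialStabilizer G u) : orbitPolytope (rotations G) u ∈ alternahedra G :=
  ⟨u, hu, similar_refl _⟩

theorem partitionNumber_permutahedra_le {G : Subgroup (Euc 3 ≃ₗᵢ[ℝ] Euc 3)}
    (hV : ∀ i, halfTurn i ∈ G) {K : Type} [Group K] [Finite K] (hK : InversionRigid K)
    {φ : K →* (Euc 3 ≃ₗᵢ[ℝ] Euc 3)} (hφ : Function.Injective φ) (hG : φ.range = G) {N : ℕ}
    (hN : N + 6 = 4 * Nat.card K) : partitionNumber (withIso (permutahedra G) K) ≤ N := by
  have := finite_of_range_eq hG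
  obtain ⟨e⟩ := nonempty_mulEquiv_of_range_eq hφ hG
  exact partitionNumber_orbitPolytope_le le_rfl hV hK e orbitPolytope_mem_permutahedra hN

theorem partitionNumber_alternahedra_le {G : Subgroup (Euc 3 ≃ₗᵢ[ℝ] Euc 3)} [Finite G]
    (hV : ∀ i, halfTurn i ∈ G) {K : Type} [Group K] (hK : InversionRigid K)
    {φ : K →* (Euc 3 ≃ₗᵢ[ℝ] Euc 3)} (hφ : Function.Injective φ) (hG : φ.range = rotations G) {N : ℕ}
    (hN : N + 6 = 4 * Nat.card K) : partitionNumber (withIso (alternahedra G) K) ≤ N := by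
  obtain ⟨e⟩ := nonempty_mulEquiv_of_range_eq hφ hG
  exact partitionNumber_orbitPolytope_le (rotations_le G) (halfTurn_mem_rotations hV) hK e
    orbitPolytope_mem_alternahedra hN

theorem partitionNumber_truncatedOctahedra_le :
    partitionNumber (withIso truncatedOctahedra (Equiv.Perm (Fin 4))) ≤ (90 : ℕ) := by
  obtain ⟨φ, hφ, hrange, -, -⟩ := exists_tetrahedralHom
  refine partitionNumber_permutahedra_le halfTurn_mem_tetrahedralGroup inversionRigid_perm_four hφ
    hrange ?_
  rw [Nat.card_perm, Nat.card_eq_fintype_card, Fintype.card_fin]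
  rfl

theorem partitionNumber_snubTetrahedra_le :
    partitionNumber (withIso snubTetrahedra (alternatingGroup (Fin 4))) ≤ (42 : ℕ) := by
  obtain ⟨φ, hφ, hrange, -, hdet⟩ := exists_tetrahedralHom
  have := finite_of_range_eq hrange
  refine partitionNumber_alternahedra_le halfTurn_mem_tetrahedralGroup
    inversionRigid_alternatingGroup_four (φ := φ.comp (alternatingGroup (Fin 4)).subtype)
    (hφ.comp Subtype.val_injective) ?_ ?_
  · ext e
    rw [mem_rotations, ← hrange]
    constructor
    · rintro ⟨p, rfl⟩
      refine ⟨⟨p, rfl⟩, (hdet p).trans ?_⟩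
      rw [Equiv.Perm.mem_alternatingGroup.1 p.2]
      simp
    · rintro ⟨⟨p, rfl⟩, h⟩
      rw [hdet] at h
      exact ⟨⟨p, Equiv.Perm.mem_alternatingGroup.2 (eq_one_of_intCast_eq_one h)⟩, rfl⟩
  · rw [nat_card_alternatingGroup, Nat.card_eq_fintype_card, Fintype.card_fin]
    rfl

theorem range_withPointReflection_octahedral {φ : Equiv.Perm (Fin 4) →* (Euc 3 ≃ₗᵢ[ℝ] Euc 3)}
    (hφ : ∀ p i, φ p (tetrahedronVertex i) = tetrahedronVertex (p i)) :
    (withPointReflection φ).range = octahedralGroup := by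
  ext e
  rw [exists_tetrahedral_mul_pointReflection hφ]
  constructor
  · rintro ⟨k, rfl⟩
    exact ⟨_, _, withPointReflection_apply φ k⟩
  · rintro ⟨p, s, rfl⟩
    obtain ⟨z, rfl⟩ := signOfZMod_bijective.2 s
    exact ⟨(p, z), rfl⟩

theorem ne_pointReflection_of_tetrahedral {φ : Equiv.Perm (Fin 4) →* (Euc 3 ≃ₗᵢ[ℝ] Euc 3)}
    (hφ : ∀ p i, φ p (tetrahedronVertex i) = tetrahedronVertex (p i)) (p : Equiv.Perm (Fin 4)) :
    φ p ≠ pointReflections 3 (-1) := by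
  intro h
  have h1 := inner_tetrahedronVertex (p 0) 0
  rw [← hφ, h, pointReflections_apply, real_inner_smul_left, inner_tetrahedronVertex] at h1
  split_ifs at h1 <;> norm_num at h1

theorem partitionNumber_truncatedCuboctahedra_le :
    partitionNumber (withIso truncatedCuboctahedra
      (Equiv.Perm (Fin 4) × Multiplicative (ZMod 2))) ≤ (186 : ℕ) := by
  obtain ⟨φ, hφ, -, hvert, -⟩ := exists_tetrahedralHom
  refine partitionNumber_permutahedra_le halfTurn_mem_octahedralGroup
    (inversionRigid_perm_four.prod zmod_two_mul_self)
    (injective_withPointReflection hφ (ne_pointReflection_of_tetrahedral hvert))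
    (range_withPointReflection_octahedral hvert) ?_
  rw [Nat.card_prod, Nat.card_perm, Nat.card_eq_fintype_card, Fintype.card_fin,
    Nat.card_eq_fintype_card]
  rfl

theorem partitionNumber_snubCubes_le :
    partitionNumber (withIso snubCubes (Equiv.Perm (Fin 4))) ≤ (90 : ℕ) := by
  obtain ⟨φ, hφ, -, hvert, hdet⟩ := exists_tetrahedralHom
  have : Finite octahedralGroup := finite_of_range_eq (range_withPointReflection_octahedral hvert)
  -- Odd permutations act on the tetrahedron with determinant -1. Composing them with the point
  -- reflection, also of determinant -1, embeds S₄ in the rotations of the cube.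
  let ψ : Equiv.Perm (Fin 4) →* (Euc 3 ≃ₗᵢ[ℝ] Euc 3) :=
    (φ.noncommCoprod (pointReflections 3) fun _ _ => commute_pointReflections _ _).comp
      ((MonoidHom.id _).prod Equiv.Perm.sign)
  have hψ : ∀ p, ψ p = φ p * pointReflections 3 (Equiv.Perm.sign p) := fun p => rfl
  have hsq : ∀ s : ℤˣ, ((s : ℤ) : ℝ) * ((s : ℤ) : ℝ) = 1 := fun s => by
    rcases Int.units_eq_one_or s with rfl | rfl <;> simp
  refine partitionNumber_alternahedra_le halfTurn_mem_octahedralGroup inversionRigid_perm_four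
    (φ := ψ) ((injective_iff_map_eq_one ψ).2 fun p hp => ?_) ?_ ?_
  · rw [hψ] at hp
    obtain ⟨s, hs⟩ : ∃ s, Equiv.Perm.sign p = s := ⟨_, rfl⟩
    rw [hs] at hp
    rcases Int.units_eq_one_or s with rfl | rfl
    · rw [map_one, mul_one] at hp
      exact (injective_iff_map_eq_one φ).1 hφ p hp
    · refine absurd ?_ (ne_pointReflection_of_tetrahedral hvert p)
      rw [eq_inv_of_mul_eq_one_left hp, ← map_inv]
      rfl
  · ext e
    rw [mem_rotations, exists_tetrahedral_mul_pointReflection hvert]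
    constructor
    · rintro ⟨p, rfl⟩
      refine ⟨⟨p, _, hψ p⟩, ?_⟩
      rw [hψ, map_mul, hdet, orthogonalDet_pointReflections, hsq]
    · rintro ⟨⟨p, s, rfl⟩, h⟩
      rw [map_mul, hdet, orthogonalDet_pointReflections] at h
      refine ⟨p, ?_⟩
      rw [hψ]
      congr 2
      rcases Int.units_eq_one_or (Equiv.Perm.sign p) with hp | hp <;>
        rcases Int.units_eq_one_or s with rfl | rfl <;> rw [hp] at h ⊢ <;> norm_num at h
  · rw [Nat.card_perm, Nat.card_eq_fintype_card, Fintype.card_fin]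
    rfl

theorem card_alternatingGroup_five : Nat.card (alternatingGroup (Fin 5)) = 60 := by
  rw [nat_card_alternatingGroup, Nat.card_eq_fintype_card, Fintype.card_fin]
  rfl

theorem ne_pointReflection_of_icosahedral
    (φ : alternatingGroup (Fin 5) →* (Euc 3 ≃ₗᵢ[ℝ] Euc 3)) (g : alternatingGroup (Fin 5)) :
    φ g ≠ pointReflections 3 (-1) := fun h => by
  have h1 := orthogonalDet_eq_one_of_alternatingGroup_five φ g
  rw [h, orthogonalDet_pointReflections] at h1
  norm_num at h1

theorem card_alternatingGroup_five_prod :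
    Nat.card (alternatingGroup (Fin 5) × Multiplicative (ZMod 2)) = 120 := by
  rw [Nat.card_prod, card_alternatingGroup_five, Nat.card_eq_fintype_card]
  rfl

/-- A₅ together with the point reflection already supplies 120 symmetries, which matches the upper
bound from the flags. -/
theorem range_withPointReflection_icosahedral
    {φ : alternatingGroup (Fin 5) →* (Euc 3 ≃ₗᵢ[ℝ] Euc 3)} (hφ : Function.Injective φ)
    (hmem : ∀ g, φ g ∈ icosahedralGroup) : (withPointReflection φ).range = icosahedralGroup := by
  obtain ⟨hfin, hcard⟩ := finite_and_card_icosahedralGroup_le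
  have hneg : pointReflections 3 (-1) ∈ icosahedralGroup := by
    have hsub : ∀ x ∈ icosahedronVertices, -x ∈ icosahedronVertices := fun x hx => by
      rw [← range_icosahedronVertex] at hx ⊢
      obtain ⟨i, rfl⟩ := hx
      have key : ∀ i : Fin 12, ∃ k, ∀ l, icosahedronCoord k l = -icosahedronCoord i l := by
        decide +kernel
      obtain ⟨k, hk⟩ := key i
      refine ⟨k, ?_⟩
      ext l
      fin_cases l <;> simp [icosahedronVertex, hk, goldenEval] <;> ring
    have hval : ∀ x : Euc 3, pointReflections 3 (-1) x = -x := fun x => by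
      simp [pointReflections_apply]
    refine Set.Subset.antisymm ?_ fun x hx => ⟨-x, hsub x hx, by rw [hval, neg_neg]⟩
    rintro _ ⟨x, hx, rfl⟩
    rw [hval]
    exact hsub x hx
  have hle : (withPointReflection φ).range ≤ icosahedralGroup := by
    rintro _ ⟨k, rfl⟩
    rw [withPointReflection_apply]
    refine mul_mem (hmem _) ?_
    rcases Int.units_eq_one_or (signOfZMod k.2) with h | h <;> rw [h]
    · rw [map_one]
      exact one_mem _
    · exact hneg
  refine Subgroup.eq_of_le_of_card_ge hle (hcard.trans_eq ?_)
  rw [← card_alternatingGroup_five_prod]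
  exact Nat.card_congr (MonoidHom.ofInjective (injective_withPointReflection hφ
    (ne_pointReflection_of_icosahedral φ))).toEquiv

theorem partitionNumber_truncatedIcosidodecahedra_le :
    partitionNumber (withIso truncatedIcosidodecahedra
      (alternatingGroup (Fin 5) × Multiplicative (ZMod 2))) ≤ (474 : ℕ) := by
  obtain ⟨φ, hφ, hmem⟩ := exists_icosahedralHom
  refine partitionNumber_permutahedra_le halfTurn_mem_icosahedralGroup
    (inversionRigid_alternatingGroup_five.prod zmod_two_mul_self)
    (injective_withPointReflection hφ (ne_pointReflection_of_icosahedral φ))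
    (range_withPointReflection_icosahedral hφ hmem) ?_
  rw [card_alternatingGroup_five_prod]

theorem partitionNumber_snubDodecahedra_le :
    partitionNumber (withIso snubDodecahedra (alternatingGroup (Fin 5))) ≤ (234 : ℕ) := by
  obtain ⟨φ, hφ, hmem⟩ := exists_icosahedralHom
  have hdet := orthogonalDet_eq_one_of_alternatingGroup_five φ
  have hrange := range_withPointReflection_icosahedral hφ hmem
  have := finite_of_range_eq hrange
  refine partitionNumber_alternahedra_le halfTurn_mem_icosahedralGroup
    inversionRigid_alternatingGroup_five hφ ?_ (by rw [card_alternatingGroup_five])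
  ext e
  rw [mem_rotations]
  constructor
  · rintro ⟨g, rfl⟩
    exact ⟨hmem g, hdet g⟩
  · rintro ⟨he, h⟩
    rw [← hrange] at he
    obtain ⟨⟨g, z⟩, rfl⟩ := he
    rw [withPointReflection_apply, map_mul, hdet, one_mul, orthogonalDet_pointReflections] at h
    have h2 : signOfZMod z = 1 := eq_one_of_intCast_eq_one h
    refine ⟨g, ?_⟩
    rw [withPointReflection_apply, h2, map_one, mul_one]

end PolytopalPartition

theorem theorem1p5 :
    (∀ n : ℕ, 3 ≤ n →
      partitionNumber (withIso (rightRegularPrisms n)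
        (DihedralGroup n × Multiplicative (ZMod 2))) ≤ ((8 * n - 6 : ℕ) : ℕ∞)) ∧
    (∀ n : ℕ, 2 ≤ n →
      partitionNumber (withIso (rightRegularAntiprisms n)
        (DihedralGroup (2 * n))) ≤ ((8 * n - 6 : ℕ) : ℕ∞)) ∧
    partitionNumber (withIso truncatedOctahedra (Equiv.Perm (Fin 4))) ≤ 90 ∧
    partitionNumber (withIso truncatedCuboctahedra
      (Equiv.Perm (Fin 4) × Multiplicative (ZMod 2))) ≤ 186 ∧
    partitionNumber (withIso truncatedIcosidodecahedra
      (alternatingGroup (Fin 5) × Multiplicative (ZMod 2))) ≤ 474 ∧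
    partitionNumber (withIso snubTetrahedra (alternatingGroup (Fin 4))) ≤ 42 ∧
    partitionNumber (withIso snubCubes (Equiv.Perm (Fin 4))) ≤ 90 ∧
    partitionNumber (withIso snubDodecahedra (alternatingGroup (Fin 5))) ≤ 234 :=
  ⟨fun _ hn => partitionNumber_prisms_le hn, fun _ hn => partitionNumber_antiprisms_le hn,
    partitionNumber_truncatedOctahedra_le, partitionNumber_truncatedCuboctahedra_le,
    partitionNumber_truncatedIcosidodecahedra_le, partitionNumber_snubTetrahedra_le,
    partitionNumber_snubCubes_le, partitionNumber_snubDodecahedra_le⟩
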